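/- **Model.** Let $G=(V,E)$ be a finite connected graph of quantum repeaters; time is divided into slots $t=0,1,2,\dots$ of duration $\Delta>0$. In each slot each of the $S(e)$ modes of a link $e$ succeeds with probability $p_0(e)=e^{-\alpha L(e)}$, and $N_t(e)=\min\{\#\text{successful modes},m_{\max}(e)\}$ new pairs of fidelity $F_0(e)\in[1/4,1]$ are retained; $\mathcal H_t=\{e:N_t(e)\ge 1\}$. Besides these, the pairs stored in the $m_{\max}(e)$ memory cells of each link are available. Knowing $N_t$ and the stored pairs with their ages and fidelities, the controller selects an action $a(t)$: at most $R$ activations of simple paths for requested source–destination pairs (flows) $(s,d)$, $s\neq d$, with the pair to be swapped on every edge; optional BBPSSW purifications on links (with a fixed bit-flip or Werner noise model; the success probability and output fidelity are the BBPSSW ones for that model); and the pairs to be kept in memory. No pair is used twice, and at most $N_t(e)$ paths are activated on $e$. A stationary policy is a measurable time-independent rule giving $a(t)$ from the observation and a uniform random seed. The Bell-state measurement of an activation at each intermediate repeater succeeds with probability $q\in(0,1]$. The Werner parameter of a pair of fidelity $F$ is $(4F-1)/3$; an end-to-end pair has as parameter the product of the parameters along the path, and storage for one slot multiplies the parameter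 by $e^{-\Delta/T_2}$. Stored pairs are lost after $T_{\mathrm{mem}}\ge1$ slots or when their fidelity falls below the threshold $F_{\min}\in(1/4,1)$. The mode outcomes, controller seeds, purification and measurement randomness are independent, independent across slots with the same law, and independent of the initially stored pairs. Let $Y_t\in\{0,1\}$ indicate that in slot $t$ some path $\pi\subseteq\mathcal H_t$ selected by $a(t)$ for a fixed flow $(s,d)$ has a pair on each edge after purification, succeeds in all its swaps, and has end-to-end fidelity at least $F_{\min}$. The Fidelity-Age of the flow is $A(u)=\Delta A_{\lfloor u/\Delta\rfloor}+(u-\Delta\lfloor u/\Delta\rfloor)$ for real times $u\ge0$, where $A_t=t-\max\{r\le t:Y_r=1\}$, and $A_t=t$ if there is no such $r$; that is, it is reset to $0$ at each delivery and grows at unit rate in between, also within slots. **Theorem (FA renewal identity).** Fix a slot duration $\Delta>0$, a stationary policy and a flow. Assume that the state process $Z_t=(N_t,\ \text{stored pairs with their ages and fidelities},\ a(t))$ is stationary and ergodic, that $0<\Pr\{Y_t=1\}<1$, and that, under the conditional law given $Y_t=1$, the inter-delivery time $\tau=\inf\{\ell\ge1:Y_{t+\ell}=1\}$ (in slots) has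 finite first and second moments. Then almost surely the long-run time-average Fidelity-Age exists and $$\lim_{T\to\infty}\frac1T\int_0^T A(u)\,du=\Delta\,\frac{\mathbb E[\tau^2\mid Y_t=1]}{2\,\mathbb E[\tau\mid Y_t=1]}.$$ In particular, if $\tau$ given $Y_t=1$ is geometric on $\{1,2,\dots\}$ with parameter $p\in(0,1]$, this limit is $\Delta(2-p)/(2p)$. -/

import Mathlib

open MeasureTheory ProbabilityTheory Filter Topology
open scoped ENNReal unitInterval

noncomputable section

namespace FidelityAge

/-- The measurable structure of `Option α` as the disjoint union of `{none}` and `α`: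
a set is measurable iff its trace on `α` is. -/
instance instMeasurableSpaceOption {α : Type*} [MeasurableSpace α] : MeasurableSpace (Option α) :=
  MeasurableSpace.map some inferInstance

/-! ### Purification -/

/-- The fixed noise model used for BBPSSW purification. -/
inductive NoiseModel
  | bitFlip
  | werner

/-- Success probability of one BBPSSW round on two pairs of fidelities `F₁`, `F₂`. -/
def NoiseModel.purifyProb : NoiseModel → ℝ → ℝ → ℝ
  | .bitFlip, F₁, F₂ => F₁ * F₂ + (1 - F₁) * (1 - F₂)
  | .werner, F₁, F₂ =>
      F₁ * F₂ + F₁ * (1 - F₂) / 3 + (1 - F₁) * F₂ / 3 + 5 * (1 - F₁) * (1 - F₂) / 9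

/-- Fidelity of the surviving pair after a successful BBPSSW round. -/
def NoiseModel.purifyFidelity : NoiseModel → ℝ → ℝ → ℝ
  | .bitFlip, F₁, F₂ => F₁ * F₂ / NoiseModel.purifyProb .bitFlip F₁ F₂
  | .werner, F₁, F₂ =>
      (F₁ * F₂ + (1 - F₁) * (1 - F₂) / 9) / NoiseModel.purifyProb .werner F₁ F₂

/-! ### The repeater network -/

/-- Fixed physical and operational parameters of a slotted repeater network on the graph `G`. -/
structure Network {V : Type*} (G : SimpleGraph V) where
  connected : G.Connected
  /-- slot duration `Δ` -/
  slot : ℝ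
  slot_pos : 0 < slot
  /-- number `S(e)` of parallel modes of a link -/
  modes : G.edgeSet → ℕ
  /-- link length `L(e)` -/
  length : G.edgeSet → ℝ
  length_pos : ∀ e, 0 < length e
  /-- fibre loss coefficient `α` -/
  loss : ℝ
  loss_pos : 0 < loss
  /-- cap `m_max(e)` on the pairs retained per slot, and on the pairs kept in memory -/
  cap : G.edgeSet → ℕ
  /-- fidelity of a fresh link-level pair -/
  freshFidelity : G.edgeSet → ℝ
  freshFidelity_mem : ∀ e, freshFidelity e ∈ Set.Icc (1 / 4 : ℝ) 1
  /-- success probability `q` of a Bell-state measurement -/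
  swapProb : I
  swapProb_pos : 0 < swapProb
  noise : NoiseModel
  /-- coherence time `T₂` -/
  coherence : ℝ
  coherence_pos : 0 < coherence
  /-- memory lifetime `T_mem`, in slots -/
  memory : ℕ
  memory_pos : 1 ≤ memory
  /-- usability threshold `F_min` -/
  threshold : ℝ
  threshold_mem : threshold ∈ Set.Ioo (1 / 4 : ℝ) 1
  /-- attempt budget `R` -/
  budget : ℕ
  /-- the source--destination requests (flows) -/
  requests : Finset (V × V)
  requests_ne : ∀ f ∈ requests, f.1 ≠ f.2

variable {V : Type*} {G : SimpleGraph V}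

/-- Per-mode success probability `p₀(e) = exp (-α L(e))`. -/
def Network.linkProb (net : Network G) (e : G.edgeSet) : I :=
  ⟨Real.exp (-(net.loss * net.length e)), (Real.exp_pos _).le,
    Real.exp_le_one_iff.2 (neg_nonpos.2 (mul_pos net.loss_pos (net.length_pos e)).le)⟩

/-- Werner parameter `(4F - 1) / 3` of a pair of fidelity `F`. -/
def wernerParam (F : ℝ) : ℝ := (4 * F - 1) / 3

/-- Fidelity `(1 + 3 p) / 4` of a Werner pair of parameter `p`. -/
def wernerFidelity (p : ℝ) : ℝ := (1 + 3 * p) / 4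

/-- Storage for one slot multiplies the Werner parameter by `exp (-Δ / T₂)`. -/
def Network.decay (net : Network G) (F : ℝ) : ℝ :=
  wernerFidelity (wernerParam F * Real.exp (-(net.slot / net.coherence)))

/-- A stored pair is described by its age in slots and its current fidelity. -/
abbrev Pair : Type := ℕ × ℝ

/-- Stored pairs: every edge `e` has `m_max(e)` memory cells, each empty or holding one pair. -/
abbrev Network.Inventory (net : Network G) : Type _ :=
  ∀ e : G.edgeSet, Fin (net.cap e) → Option Pair

/-- The external multigraph of a slot: the number of newly retained pairs on every edge. -/
abbrev External (G : SimpleGraph V) : Type _ := G.edgeSet → ℕ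

/-- Names of the pairs that may be present on edge `e` within a slot: the contents of a memory
cell (`inl`), or one of the newly retained pairs (`inr`). -/
abbrev Network.PairName (net : Network G) (e : G.edgeSet) : Type :=
  Fin (net.cap e) ⊕ Fin (net.cap e)

/-- The pairs present on an edge after the external phase. -/
def Network.pool (net : Network G) (n : External G) (s : net.Inventory) (e : G.edgeSet) :
    net.PairName e → Option Pair
  | .inl i => s e i
  | .inr i => if (i : ℕ) < n e then some (0, net.freshFidelity e) else none

/-! ### Controller actions -/

/-- Activation of a simple path for a flow, with the pair to be swapped on every edge
(only the choices on the edges of the path matter). -/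
structure Network.Activation (net : Network G) where
  flow : V × V
  path : G.Path flow.1 flow.2
  pick : ∀ e : G.edgeSet, net.PairName e

/-- The edge `e` lies on the activated path. -/
def Network.Activation.Uses {net : Network G} (A : net.Activation) (e : G.edgeSet) : Prop :=
  (e : Sym2 V) ∈ (A.path : G.Walk A.flow.1 A.flow.2).edges

/-- An action: at most `R` path activations, optional purifications
(`purify e r = some r'`: pair `r` is purified at the cost of pair `r'`), and the pairs
that go to the memory cells at the end of the slot. -/
structure Network.Action (net : Network G) where
  activate : Fin net.budget → Option net.Activation
  purify : ∀ e : G.edgeSet, net.PairName e → Option (net.PairName e)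
  keep : ∀ e : G.edgeSet, Fin (net.cap e) → Option (net.PairName e)

instance Network.instMeasurableSpaceAction (net : Network G) : MeasurableSpace net.Action := ⊤

/-- Feasibility of an action, given the external multigraph and the stored pairs. -/
structure Network.Feasible (net : Network G) (n : External G) (s : net.Inventory)
    (a : net.Action) : Prop where
  /-- only requested flows are served -/
  flow_mem : ∀ j A, a.activate j = some A → A.flow ∈ net.requests
  /-- purification acts on two distinct existing pairs of the same link -/
  purify_ne : ∀ e r r', a.purify e r = some r' → r ≠ r'
  purify_left : ∀ e r r', a.purify e r = some r' → (net.pool n s e r).isSome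
  purify_right : ∀ e r r', a.purify e r = some r' → (net.pool n s e r').isSome
  /-- every pair takes part in at most one purification -/
  purify_once : ∀ e r r', a.purify e r = some r' → a.purify e r' = none
  purify_inj : ∀ e r₁ r₂ r', a.purify e r₁ = some r' → a.purify e r₂ = some r' → r₁ = r₂
  /-- swapped pairs exist and are not given up in a purification -/
  pick_isSome : ∀ j A, a.activate j = some A → ∀ e, A.Uses e →
    (net.pool n s e (A.pick e)).isSome
  pick_left : ∀ j A, a.activate j = some A → ∀ e, A.Uses e → ∀ r, a.purify e r ≠ some (A.pick e)
  /-- no pair is swapped on two paths -/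
  pick_inj : ∀ j₁ j₂ A₁ A₂, a.activate j₁ = some A₁ → a.activate j₂ = some A₂ → j₁ ≠ j₂ →
    ∀ e, A₁.Uses e → A₂.Uses e → A₁.pick e ≠ A₂.pick e
  /-- at most as many paths are activated on an edge as there are newly retained pairs on it -/
  multiplicity : ∀ e, {j | ∃ A, a.activate j = some A ∧ A.Uses e}.ncard ≤ n e
  /-- a pair is kept in at most one cell, and only if it was not swapped -/
  keep_inj : ∀ e i₁ i₂ r, a.keep e i₁ = some r → a.keep e i₂ = some r → i₁ = i₂
  keep_unused : ∀ e i r, a.keep e i = some r →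
    ∀ j A, a.activate j = some A → A.Uses e → A.pick e ≠ r

/-- A stationary nonanticipative (possibly randomized) policy: the action is a time-independent
function of the observed external successes, the stored pairs, and a uniform random seed. -/
structure Network.Policy (net : Network G) where
  act : External G × net.Inventory × I → net.Action
  measurable_act : Measurable act
  feasible : ∀ n s u, net.Feasible n s (act (n, s, u))

/-! ### Randomness of one slot -/

/-- Success indicators of all modes of all edges. -/
abbrev Network.ModeOutcomes (net : Network G) : Type _ :=
  ∀ e : G.edgeSet, Fin (net.modes e) → Bool

/-- Internal randomness: uniform variables that decide the purification rounds, and the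
outcome of the Bell-state measurement of every activation at every repeater. -/
abbrev Network.Internal (net : Network G) : Type _ :=
  (∀ e : G.edgeSet, net.PairName e → I) × (Fin net.budget → V → Bool)

/-- All randomness of one slot: mode outcomes, seed of the controller, internal randomness. -/
abbrev Network.SlotNoise (net : Network G) : Type _ :=
  (net.ModeOutcomes × I) × net.Internal

/-- All random variables of a slot are independent; modes succeed with probability `p₀(e)`,
Bell-state measurements with probability `q`. -/
def Network.slotLaw [Fintype V] [DecidableEq V] [DecidableRel G.Adj] (net : Network G) :
    Measure net.SlotNoise :=
  ((Measure.pi fun e => Measure.pi fun _ => bernoulliMeasure true false (net.linkProb e)).prod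
      volume).prod
    ((Measure.pi fun _ => Measure.pi fun _ => volume).prod
      (Measure.pi fun _ => Measure.pi fun _ => bernoulliMeasure true false net.swapProb))

/-- Newly retained pairs: `min (number of successful modes) (m_max e)`. -/
def Network.retained (net : Network G) (x : net.ModeOutcomes) : External G :=
  fun e => min (Finset.univ.filter fun i => x e i = true).card (net.cap e)

/-! ### Internal phase -/

open Classical in
/-- The pairs on an edge after the purifications: a purified pair survives with the success
probability of the round, with improved fidelity; a pair given up is gone. -/
def Network.afterPurify (net : Network G) (n : External G) (s : net.Inventory) (a : net.Action)
    (w : net.Internal) (e : G.edgeSet) (r : net.PairName e) : Option Pair :=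
  match a.purify e r with
  | none => if ∃ r', a.purify e r' = some r then none else net.pool n s e r
  | some r' =>
      (net.pool n s e r).bind fun p => (net.pool n s e r').bind fun p' =>
        if (w.1 e r : ℝ) < net.noise.purifyProb p.2 p'.2 then
          some (p.1, net.noise.purifyFidelity p.2 p'.2)
        else none

/-- End of a slot: the pair ages by one slot and decoheres; it is lost when its lifetime is over
or its fidelity is below the threshold. -/
def Network.store (net : Network G) (p : Pair) : Option Pair :=
  if p.1 + 1 < net.memory ∧ net.threshold ≤ net.decay p.2 then some (p.1 + 1, net.decay p.2)
  else none

/-- The stored pairs at the beginning of the next slot. -/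
def Network.next (net : Network G) (n : External G) (s : net.Inventory) (a : net.Action)
    (w : net.Internal) : net.Inventory :=
  fun e i => (a.keep e i).bind fun r => (net.afterPurify n s a w e r).bind net.store

open Classical in
/-- End-to-end fidelity of an activated path: the Werner parameters of its edges multiply. -/
def Network.endFidelity [Fintype V] [DecidableEq V] [DecidableRel G.Adj] (net : Network G)
    (n : External G) (s : net.Inventory) (a : net.Action) (w : net.Internal)
    (A : net.Activation) : ℝ :=
  wernerFidelity (∏ e : G.edgeSet, if A.Uses e then
    ((net.afterPurify n s a w e (A.pick e)).elim 0 fun p => wernerParam p.2) else 1)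

/-- A usable delivery to `flow`: the action selects a simple path for it, contained in the
support of the external multigraph, which has a pair on every edge, all of whose swaps succeed,
and whose end-to-end fidelity reaches the threshold. -/
def Network.Usable [Fintype V] [DecidableEq V] [DecidableRel G.Adj] (net : Network G)
    (flow : V × V) (n : External G) (s : net.Inventory) (a : net.Action) (w : net.Internal) :
    Prop :=
  ∃ j A, a.activate j = some A ∧ A.flow = flow ∧
    (∀ e, A.Uses e → 1 ≤ n e ∧ (net.afterPurify n s a w e (A.pick e)).isSome) ∧
    (∀ v ∈ (A.path : G.Walk A.flow.1 A.flow.2).support,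
      v ≠ flow.1 → v ≠ flow.2 → w.2 j v = true) ∧
    net.threshold ≤ net.endFidelity n s a w A

/-! ### The controlled system -/

/-- The state of the system in a slot: external multigraph, stored pairs, action. -/
abbrev Network.State (net : Network G) : Type _ := External G × net.Inventory × net.Action

/-- The state of a slot, from the stored pairs and the randomness of the slot. -/
def Network.observe (net : Network G) (φ : net.Policy) (s : net.Inventory) (x : net.SlotNoise) :
    net.State :=
  (net.retained x.1.1, s, φ.act (net.retained x.1.1, s, x.1.2))

/-- Stored pairs at the beginning of slot `t`, started from `s₀` and driven by `ξ`. -/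
def Network.inventory {Ω : Type*} (net : Network G) (φ : net.Policy) (s₀ : Ω → net.Inventory)
    (ξ : ℕ → Ω → net.SlotNoise) : ℕ → Ω → net.Inventory
  | 0, ω => s₀ ω
  | t + 1, ω =>
      let z := net.observe φ (net.inventory φ s₀ ξ t ω) (ξ t ω)
      net.next z.1 z.2.1 z.2.2 (ξ t ω).2

/-- The state `Z_t` of the system. -/
def Network.state {Ω : Type*} (net : Network G) (φ : net.Policy) (s₀ : Ω → net.Inventory)
    (ξ : ℕ → Ω → net.SlotNoise) (t : ℕ) (ω : Ω) : net.State :=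
  net.observe φ (net.inventory φ s₀ ξ t ω) (ξ t ω)

open Classical in
/-- The indicator `Y_t ∈ {0, 1}` of a usable delivery to `flow` in slot `t`. -/
def Network.delivery {Ω : Type*} [Fintype V] [DecidableEq V] [DecidableRel G.Adj]
    (net : Network G) (φ : net.Policy) (flow : V × V) (s₀ : Ω → net.Inventory)
    (ξ : ℕ → Ω → net.SlotNoise) (t : ℕ) (ω : Ω) : ℕ :=
  let z := net.state φ s₀ ξ t ω
  if net.Usable flow z.1 z.2.1 z.2.2 (ξ t ω).2 then 1 else 0

/-- The slots are driven by i.i.d. randomness with the law of the model, independent of the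
pairs that are stored initially (whose law is not prescribed). -/
structure Network.IsDriven {Ω : Type*} [MeasurableSpace Ω] [Fintype V] [DecidableEq V]
    [DecidableRel G.Adj] (net : Network G) (P : Measure Ω) (s₀ : Ω → net.Inventory)
    (ξ : ℕ → Ω → net.SlotNoise) : Prop where
  measurable_init : Measurable s₀
  measurable_noise : ∀ t, Measurable (ξ t)
  law_noise : ∀ t, P.map (ξ t) = net.slotLaw
  indep_noise : iIndepFun ξ P
  indep_init : IndepFun s₀ (fun ω t => ξ t ω) P

/-- A sequence of random variables is stationary and ergodic: the shift on the path space is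
measure preserving and ergodic for the law of the sequence. -/
def IsStationaryErgodic {Ω S : Type*} [MeasurableSpace Ω] [MeasurableSpace S] (P : Measure Ω)
    (Z : ℕ → Ω → S) : Prop :=
  Ergodic (fun (z : ℕ → S) (t : ℕ) => z (t + 1)) (P.map fun ω t => Z t ω)

/-! ### Inter-delivery time and Fidelity-Age -/

/-- Number of slots from slot `t` to the next delivery, `inf {ℓ ≥ 1 : Y_{t+ℓ} = 1}`, which is
infinite if there is none. -/
def interDelivery (y : ℕ → ℕ) (t : ℕ) : ℕ∞ := ⨅ ℓ ∈ {ℓ : ℕ | 1 ≤ ℓ ∧ y (t + ℓ) = 1}, (ℓ : ℕ∞)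

/-- Number of slots since the last delivery; it is `t` if there is none up to slot `t`, since
`sSup ∅ = 0` in `ℕ`. -/
def slotAge (y : ℕ → ℕ) (t : ℕ) : ℕ := t - sSup {r : ℕ | r ≤ t ∧ y r = 1}

/-- Fidelity-Age at the time `u ≥ 0`, for slots of duration `Δ` (slot `t` begins at the time
`t Δ`): it vanishes at a delivery and grows at unit rate, also within a slot, until the next. -/
def fidelityAge (Δ : ℝ) (y : ℕ → ℕ) (u : ℝ) : ℝ :=
  Δ * slotAge y ⌊u / Δ⌋₊ + (u - Δ * ⌊u / Δ⌋₊)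

end FidelityAge

end

/-! The age is a sawtooth. A slot that begins at age `a` (in slots) contributes area `Δ² (2a + 1) /
2`, and since `2a + 1 = (a + 1)² - a²`, a whole cycle of length `τ` contributes `Δ² τ² / 2`. The
time average is therefore half the sum of squared cycle lengths per slot, up to the incomplete
cycles at the two ends (`sum_slotAge`). The last one is negligible: once the averages of the squares
converge, a single square is `o(n)` (`tendsto_cycle_sq_div`).

Birkhoff's theorem (`ae_tendsto_birkhoffSum_div`), applied to `τ² 1{Y = 1}`, gives the limit `E[τ²;
Y = 1]`. Applied to `τ 1{Y = 1}`, whose averages tend to `1` because the cycles tile the time axis,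
it gives Kac's formula `E[τ; Y = 1] = 1`. Hence `P{Y = 1} = 1 / E[τ | Y = 1]`, which turns the limit
into the stated ratio.

Ergodicity is assumed for the state process only, whereas a delivery also depends on purification
and measurement randomness outside the state. So `Y` need not be a function of the path of `Z`, and
ergodicity has to be lifted to the system formed by the stored pairs and the entire i.i.d. noise
sequence (`ergodic_skewShift_of_isStationaryErgodic`). Given the past, an invariant event of that
system has a conditional probability depending only on the current stored pairs. By Lévy's 0-1 law
these probabilities converge to an indicator, and by stationarity they already are `0` or `1` at
time `0` (`exists_ae_eq_preimage_fst_of_invariant`). The event is thus a set of stored pairs, which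
is visible in `Z`, hence trivial. `Y` is then a factor of an ergodic system. -/

namespace FidelityAge

/-! ### Birkhoff's pointwise ergodic theorem -/

section PointwiseErgodic

variable {α : Type*} {T : α → α} {f : α → ℝ}

/-- The maximum of `0` and the first `n` Birkhoff sums of `f`. -/
def maxBirkhoffSum (T : α → α) (f : α → ℝ) : ℕ → α → ℝ
  | 0 => fun _ => 0
  | n + 1 => fun x => max 0 (f x + maxBirkhoffSum T f n (T x))

lemma maxBirkhoffSum_nonneg (n : ℕ) (x : α) : 0 ≤ maxBirkhoffSum T f n x := by
  cases n <;> simp [maxBirkhoffSum]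

lemma maxBirkhoffSum_le_succ (n : ℕ) (x : α) :
    maxBirkhoffSum T f n x ≤ maxBirkhoffSum T f (n + 1) x := by
  induction n generalizing x with
  | zero => exact maxBirkhoffSum_nonneg 1 x
  | succ n ih => exact max_le_max le_rfl (by simpa using ih (T x))

lemma maxBirkhoffSum_mono (x : α) : Monotone fun n => maxBirkhoffSum T f n x :=
  monotone_nat_of_le_succ fun n => maxBirkhoffSum_le_succ n x

lemma birkhoffSum_le_maxBirkhoffSum (n : ℕ) (x : α) :
    birkhoffSum T f n x ≤ maxBirkhoffSum T f n x := by
  induction n generalizing x with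
  | zero => simp [maxBirkhoffSum]
  | succ n ih =>
    rw [birkhoffSum_succ']
    exact le_max_of_le_right (by simpa using ih (T x))

/-- The core of the maximal argument: the difference is bounded by `|f x|`, and equals `f x` as soon
as the maximum at `T x` exceeds `-f x`. -/
lemma maxBirkhoffSum_succ_sub (n : ℕ) (x : α) :
    maxBirkhoffSum T f (n + 1) x - maxBirkhoffSum T f n (T x) =
      max (-maxBirkhoffSum T f n (T x)) (f x) := by
  simp only [maxBirkhoffSum]
  rw [max_sub_sub_right _ _ _ |>.symm]
  simp

/-- Passing from `x` to `T x` changes the Birkhoff sums by the finite amount `f x`. Exact invariance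
makes the zero-one alternative available. -/
lemma preimage_not_bddAbove_maxBirkhoffSum :
    T ⁻¹' {x | ¬ BddAbove (Set.range fun n => maxBirkhoffSum T f n x)} =
      {x | ¬ BddAbove (Set.range fun n => maxBirkhoffSum T f n x)} := by
  ext x
  simp only [Set.mem_preimage, Set.mem_ofPred_eq, not_iff_not]
  constructor
  · rintro ⟨K, hK⟩
    refine ⟨max 0 (f x + K), ?_⟩
    rintro _ ⟨n, rfl⟩
    cases n with
    | zero => exact le_max_left _ _
    | succ n => exact max_le_max le_rfl (by simpa using hK ⟨n, rfl⟩)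
  · rintro ⟨K, hK⟩
    refine ⟨K - f x, ?_⟩
    rintro _ ⟨n, rfl⟩
    have h : maxBirkhoffSum T f (n + 1) x ≤ K := hK ⟨n + 1, rfl⟩
    have h' : f x + maxBirkhoffSum T f n (T x) ≤ maxBirkhoffSum T f (n + 1) x := le_max_right _ _
    show maxBirkhoffSum T f n (T x) ≤ K - f x
    linarith

lemma birkhoffSum_sub_const (c : ℝ) (n : ℕ) (x : α) :
    birkhoffSum T (fun x => f x - c) n x = birkhoffSum T f n x - n * c := by
  simp [birkhoffSum, Finset.sum_sub_distrib]

variable [MeasurableSpace α] {μ : Measure α}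

lemma measurable_maxBirkhoffSum (hT : Measurable T) (hf : Measurable f) (n : ℕ) :
    Measurable (maxBirkhoffSum T f n) := by
  induction n with
  | zero => exact measurable_const
  | succ n ih => exact measurable_const.max (hf.add (ih.comp hT))

lemma integrable_maxBirkhoffSum [IsFiniteMeasure μ] (hT : MeasurePreserving T μ μ)
    (hfi : Integrable f μ) (n : ℕ) : Integrable (maxBirkhoffSum T f n) μ := by
  induction n with
  | zero => exact integrable_const _
  | succ n ih => exact (integrable_const (0 : ℝ)).sup (hfi.add (hT.integrable_comp_of_integrable ih))

/-- For an ergodic map, the Birkhoff sums of a function of negative mean are almost surely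
bounded above. -/
lemma ae_bddAbove_birkhoffSum [IsProbabilityMeasure μ] (hT : Ergodic T μ) (hf : Measurable f)
    (hfi : Integrable f μ) (hneg : ∫ x, f x ∂μ < 0) :
    ∀ᵐ x ∂μ, BddAbove (Set.range fun n => birkhoffSum T f n x) := by
  have hmp := hT.toMeasurePreserving
  have hmeas := measurable_maxBirkhoffSum (f := f) hmp.measurable hf
  have hint := integrable_maxBirkhoffSum hmp hfi
  set D := {x | ¬ BddAbove (Set.range fun n => maxBirkhoffSum T f n x)} with hD
  have hDm : MeasurableSet D := (measurableSet_bddAbove_range hmeas).compl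
  rcases hT.toPreErgodic.ae_mem_or_ae_notMem hDm preimage_not_bddAbove_maxBirkhoffSum with h | h
  · exfalso
    -- If the maxima diverge almost everywhere, these differences are eventually equal to `f`; their
    -- integrals are nonnegative by monotonicity in `n` and invariance of `μ`, contradicting the
    -- negative mean.
    have hlim : Tendsto (fun n => ∫ x, (maxBirkhoffSum T f (n + 1) x -
        maxBirkhoffSum T f n (T x)) ∂μ) atTop (𝓝 (∫ x, f x ∂μ)) := by
      refine tendsto_integral_of_dominated_convergence (fun x => |f x|) (fun n => ?_) hfi.abs
        (fun n => ?_) ?_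
      · exact ((hmeas (n + 1)).sub ((hmeas n).comp hmp.measurable)).aestronglyMeasurable
      · refine ae_of_all _ fun x => ?_
        rw [maxBirkhoffSum_succ_sub, Real.norm_eq_abs]
        refine abs_le.2 ⟨le_max_of_le_right (neg_abs_le _), max_le ?_ (le_abs_self _)⟩
        exact (neg_nonpos.2 (maxBirkhoffSum_nonneg _ _)).trans (abs_nonneg _)
      · filter_upwards [h] with x hx
        have hx' : T x ∈ D := by
          rw [← Set.mem_preimage, hD, preimage_not_bddAbove_maxBirkhoffSum]; exact hx
        have hinf : Tendsto (fun n => maxBirkhoffSum T f n (T x)) atTop atTop :=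
          tendsto_atTop_atTop_of_monotone' (maxBirkhoffSum_mono _) hx'
        refine tendsto_const_nhds.congr' ?_
        filter_upwards [hinf.eventually_ge_atTop (-f x)] with n hn
        rw [maxBirkhoffSum_succ_sub, max_eq_right (by linarith)]
    refine hneg.not_ge (ge_of_tendsto' hlim fun n => ?_)
    rw [integral_sub (g := fun x => maxBirkhoffSum T f n (T x)) (hint _)
        (hmp.integrable_comp_of_integrable (hint n)),
      show ∫ x, maxBirkhoffSum T f n (T x) ∂μ = ∫ x, maxBirkhoffSum T f n x ∂μ from ?_, sub_nonneg]
    · exact integral_mono (hint n) (hint _) (maxBirkhoffSum_le_succ n)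
    · conv_rhs => rw [← hmp.map_eq]
      exact (integral_map hmp.measurable.aemeasurable
        (hmeas n).aestronglyMeasurable).symm
  · filter_upwards [h] with x hx
    obtain ⟨K, hK⟩ := not_not.1 hx
    refine ⟨K, ?_⟩
    rintro _ ⟨n, rfl⟩
    exact (birkhoffSum_le_maxBirkhoffSum n x).trans (hK ⟨n, rfl⟩)

lemma ae_eventually_birkhoffSum_le [IsProbabilityMeasure μ] (hT : Ergodic T μ) (hf : Measurable f)
    (hfi : Integrable f μ) {ε : ℝ} (hε : 0 < ε) :
    ∀ᵐ x ∂μ, ∀ᶠ n : ℕ in atTop, birkhoffSum T f n x / n ≤ ∫ x, f x ∂μ + ε := by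
  -- Half of `ε` makes the mean negative; the other half absorbs the bound `K / n`.
  have hneg : ∫ x, (f x - (∫ x, f x ∂μ + ε / 2)) ∂μ < 0 := by
    rw [integral_sub hfi (integrable_const _)]
    simp [hε]
  filter_upwards [ae_bddAbove_birkhoffSum hT (hf.sub_const _)
    (hfi.sub (integrable_const _)) hneg] with x hx
  obtain ⟨K, hK⟩ := hx
  filter_upwards [(tendsto_const_div_atTop_nhds_zero_nat K).eventually_le_const
    (half_pos hε), eventually_gt_atTop 0] with n hn hn0
  have h : birkhoffSum T (fun x => f x - (∫ x, f x ∂μ + ε / 2)) n x ≤ K := hK ⟨n, rfl⟩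
  rw [birkhoffSum_sub_const] at h
  have hn0' : (0 : ℝ) < n := Nat.cast_pos.2 hn0
  rw [div_le_iff₀ hn0'] at hn ⊢
  linarith

/-- **Pointwise ergodic theorem** for an ergodic map. -/
theorem ae_tendsto_birkhoffSum_div [IsProbabilityMeasure μ] (hT : Ergodic T μ) (hf : Measurable f)
    (hfi : Integrable f μ) :
    ∀ᵐ x ∂μ, Tendsto (fun n : ℕ => birkhoffSum T f n x / n) atTop (𝓝 (∫ x, f x ∂μ)) := by
  have hpos : ∀ k : ℕ, (0 : ℝ) < 1 / (k + 1) := fun k => Nat.one_div_pos_of_nat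
  have h1 := ae_all_iff.2 fun k => ae_eventually_birkhoffSum_le hT hf hfi (hpos k)
  have h2 := ae_all_iff.2 fun k => ae_eventually_birkhoffSum_le hT hf.neg hfi.neg (hpos k)
  filter_upwards [h1, h2] with x h1 h2
  rw [Metric.tendsto_atTop']
  intro ε hε
  obtain ⟨k, hk⟩ := exists_nat_one_div_lt hε
  have key : ∀ᶠ n : ℕ in atTop, dist (birkhoffSum T f n x / n) (∫ x, f x ∂μ) < ε := by
    filter_upwards [h1 k, h2 k] with n h1 h2
    have e : birkhoffSum T (-f) n x = -birkhoffSum T f n x := by simp [birkhoffSum]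
    rw [e, neg_div] at h2
    simp only [Pi.neg_apply, integral_neg] at h2
    rw [Real.dist_eq, abs_lt]
    constructor <;> linarith
  obtain ⟨N, hN⟩ := eventually_atTop.1 key
  exact ⟨N, fun n hn => hN n hn.le⟩

end PointwiseErgodic

/-! ### Pathwise accounting of cycles -/

section Deterministic

variable {y : ℕ → ℕ}

lemma slotAge_le (y : ℕ → ℕ) (t : ℕ) : slotAge y t ≤ t := Nat.sub_le _ _

lemma slotAge_of_delivery {t : ℕ} (h : y t = 1) : slotAge y t = 0 := by
  have : t ≤ sSup {r : ℕ | r ≤ t ∧ y r = 1} :=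
    le_csSup ⟨t, fun r hr => hr.1⟩ ⟨le_rfl, h⟩
  exact Nat.sub_eq_zero_of_le this

lemma slotAge_succ {t : ℕ} (h : y (t + 1) ≠ 1) : slotAge y (t + 1) = slotAge y t + 1 := by
  have hset : {r : ℕ | r ≤ t + 1 ∧ y r = 1} = {r : ℕ | r ≤ t ∧ y r = 1} := by
    ext r
    simp only [Set.mem_ofPred_eq]
    constructor
    · rintro ⟨h1, h2⟩
      exact ⟨by rcases h1.lt_or_eq with h3 | rfl; exacts [by omega, absurd h2 h], h2⟩
    · rintro ⟨h1, h2⟩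
      exact ⟨by omega, h2⟩
  have hle : sSup {r : ℕ | r ≤ t ∧ y r = 1} ≤ t := csSup_le' fun r hr => hr.1
  unfold slotAge
  rw [hset]
  omega

/-- Number of slots from slot `t` to the first delivery in slot `t` or later. -/
noncomputable def waitTime (y : ℕ → ℕ) (t : ℕ) : ℕ := sInf {ℓ | y (t + ℓ) = 1}

lemma waitTime_of_delivery {t : ℕ} (h : y t = 1) : waitTime y t = 0 :=
  Nat.sInf_eq_zero.2 (Or.inl (by simpa using h))

/-- A later delivery must exist: otherwise both waiting times would be the default value `sInf ∅ =
0`. -/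
lemma waitTime_of_not_delivery (hy : ∀ n, ∃ ℓ, y (n + ℓ) = 1) {t : ℕ} (h : y t ≠ 1) :
    waitTime y t = waitTime y (t + 1) + 1 := by
  have h1 : y (t + 1 + waitTime y (t + 1)) = 1 := Nat.sInf_mem (hy (t + 1))
  have h2 : y (t + waitTime y t) = 1 := Nat.sInf_mem (hy t)
  have h3 : waitTime y t ≤ waitTime y (t + 1) + 1 :=
    Nat.sInf_le (show y (t + (waitTime y (t + 1) + 1)) = 1 by
      convert h1 using 2; ring)
  have h4 : waitTime y t ≠ 0 := fun h0 => h (by simpa [h0] using h2)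
  obtain ⟨k, hk⟩ := Nat.exists_eq_succ_of_ne_zero h4
  have h5 : waitTime y (t + 1) ≤ k :=
    Nat.sInf_le (show y (t + 1 + k) = 1 by
      convert h2 using 2; omega)
  omega

/-- The inter-delivery time ignores slot `t` itself, so the wait is counted from slot `t + 1`, plus
one. -/
lemma interDelivery_eq_waitTime (hy : ∀ n, ∃ ℓ, y (n + ℓ) = 1) (t : ℕ) :
    interDelivery y t = ((waitTime y (t + 1) + 1 : ℕ) : ℕ∞) := by
  have h1 : y (t + 1 + waitTime y (t + 1)) = 1 := Nat.sInf_mem (hy (t + 1))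
  apply le_antisymm
  · refine iInf₂_le (waitTime y (t + 1) + 1) ⟨by omega, ?_⟩
    convert h1 using 2; ring
  · refine le_iInf₂ fun ℓ hℓ => ?_
    obtain ⟨k, rfl⟩ := Nat.exists_eq_add_of_le hℓ.1
    have : waitTime y (t + 1) ≤ k :=
      Nat.sInf_le (show y (t + 1 + k) = 1 by
        convert hℓ.2 using 2; ring)
    exact_mod_cast (by omega : waitTime y (t + 1) + 1 ≤ 1 + k)

/-- Age reached at the end of the slot before slot `t`. -/
noncomputable def ageBefore (y : ℕ → ℕ) : ℕ → ℕ
  | 0 => 0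
  | t + 1 => slotAge y t + 1

lemma slotAge_eq_ageBefore {t : ℕ} (h : y t ≠ 1) : slotAge y t = ageBefore y t := by
  cases t with
  | zero => exact Nat.le_zero.1 (slotAge_le y 0)
  | succ t => exact slotAge_succ h

/-- The `k`-th power of the time from slot `t` to the next delivery, if slot `t` delivers. -/
noncomputable def cycleMoment (k : ℕ) (y : ℕ → ℕ) (t : ℕ) : ℝ :=
  if y t = 1 then ((interDelivery y t).toNat : ℝ) ^ k else 0

lemma cycleMoment_of_delivery (hy : ∀ n, ∃ ℓ, y (n + ℓ) = 1) (k : ℕ) {t : ℕ} (h : y t = 1) :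
    cycleMoment k y t = ((waitTime y (t + 1) : ℝ) + 1) ^ k := by
  rw [cycleMoment, if_pos h, interDelivery_eq_waitTime hy, ENat.toNat_natCast]
  push_cast
  rfl

/-- Cycles started before `n`, preceded by the initial wait, tile the slots up to the first delivery
at or after `n`. -/
lemma sum_cycleMoment_one (hy : ∀ n, ∃ ℓ, y (n + ℓ) = 1) (n : ℕ) :
    (n : ℝ) + waitTime y n = ∑ t ∈ Finset.range n, cycleMoment 1 y t + waitTime y 0 := by
  induction n with
  | zero => simp
  | succ n ih =>
    rw [Finset.sum_range_succ]
    by_cases h : y n = 1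
    · rw [cycleMoment_of_delivery hy 1 h]
      rw [waitTime_of_delivery h] at ih
      push_cast at ih ⊢
      linarith
    · rw [cycleMoment, if_neg h]
      rw [waitTime_of_not_delivery hy h] at ih
      push_cast at ih ⊢
      linarith

/-- Each summand `2a + 1` is an increment of squares, so a full cycle sums to its squared length.
The bracket on the left is the part of the current cycle still to come; it vanishes when slot `n`
delivers. -/
lemma sum_slotAge (hy : ∀ n, ∃ ℓ, y (n + ℓ) = 1) (n : ℕ) :
    ∑ t ∈ Finset.range n, (2 * (slotAge y t : ℝ) + 1) +
        (((ageBefore y n : ℝ) + waitTime y n) ^ 2 - (ageBefore y n : ℝ) ^ 2) =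
      ∑ t ∈ Finset.range n, cycleMoment 2 y t + (waitTime y 0 : ℝ) ^ 2 := by
  induction n with
  | zero => simp [ageBefore]
  | succ n ih =>
    rw [Finset.sum_range_succ, Finset.sum_range_succ, ageBefore]
    by_cases h : y n = 1
    · rw [cycleMoment_of_delivery hy 2 h, slotAge_of_delivery h]
      rw [waitTime_of_delivery h] at ih
      push_cast at ih ⊢
      linarith
    · rw [cycleMoment, if_neg h, slotAge_eq_ageBefore h]
      rw [waitTime_of_not_delivery hy h] at ih
      push_cast at ih ⊢
      linarith

/-- Age plus remaining wait is the length of the current cycle, unchanged until the next delivery;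
the first alternative is the initial stretch before any delivery counted so far. -/
lemma ageBefore_add_waitTime (hy : ∀ n, ∃ ℓ, y (n + ℓ) = 1) (n : ℕ) :
    ageBefore y n + waitTime y n = waitTime y 0 ∨
      ∃ t < n, ((ageBefore y n : ℝ) + waitTime y n) ^ 2 = cycleMoment 2 y t := by
  induction n with
  | zero => simp [ageBefore]
  | succ n ih =>
    by_cases h : y n = 1
    · refine Or.inr ⟨n, by omega, ?_⟩
      rw [cycleMoment_of_delivery hy 2 h, ageBefore, slotAge_of_delivery h]
      push_cast
      ring
    · have e : ageBefore y (n + 1) + waitTime y (n + 1) = ageBefore y n + waitTime y n := by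
        rw [ageBefore, slotAge_eq_ageBefore h, waitTime_of_not_delivery hy h]
        ring
      rcases ih with ih | ⟨t, ht, ih⟩
      · exact Or.inl (e.trans ih)
      · refine Or.inr ⟨t, by omega, ?_⟩
        rw [← ih]
        exact_mod_cast congrArg (· ^ 2) e

lemma cycleMoment_nonneg (k : ℕ) (y : ℕ → ℕ) (t : ℕ) : 0 ≤ cycleMoment k y t := by
  unfold cycleMoment
  split_ifs <;> positivity

/-- A term is the difference of two consecutive partial sums, and both normalised sums have the same
limit. -/
lemma tendsto_div_of_tendsto_sum_div {a : ℕ → ℝ} {c : ℝ}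
    (h : Tendsto (fun n : ℕ => (∑ t ∈ Finset.range n, a t) / n) atTop (𝓝 c)) :
    Tendsto (fun n : ℕ => a n / (n + 1)) atTop (𝓝 0) := by
  have h1 := (tendsto_add_atTop_iff_nat 1).2 h
  have h2 := h.mul (tendsto_natCast_div_add_atTop (1 : ℝ))
  have h3 := h1.sub h2
  rw [mul_one, sub_self] at h3
  refine h3.congr' ?_
  filter_upwards [eventually_gt_atTop 0] with n hn
  have hn' : (n : ℝ) ≠ 0 := by positivity
  rw [Finset.sum_range_succ]
  push_cast
  field_simp
  ring

/-- The square of the length of the cycle that contains slot `n` is of smaller order than `n`. -/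
lemma tendsto_cycle_sq_div (hy : ∀ n, ∃ ℓ, y (n + ℓ) = 1) {c : ℝ}
    (h : Tendsto (fun n : ℕ => (∑ t ∈ Finset.range n, cycleMoment 2 y t) / n) atTop (𝓝 c)) :
    Tendsto (fun n : ℕ => ((ageBefore y n : ℝ) + waitTime y n) ^ 2 / n) atTop (𝓝 0) := by
  have h0 := tendsto_div_of_tendsto_sum_div h
  rw [Metric.tendsto_atTop']
  intro ε hε
  obtain ⟨N, hN⟩ := eventually_atTop.1 (h0.eventually_le_const (half_pos hε))
  set K : ℝ := (waitTime y 0 : ℝ) ^ 2 + ∑ t ∈ Finset.range N, cycleMoment 2 y t with hK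
  have hsum : 0 ≤ ∑ t ∈ Finset.range N, cycleMoment 2 y t :=
    Finset.sum_nonneg fun t _ => cycleMoment_nonneg 2 y t
  -- The current cycle started at some `t < n`. Starts before `N` and the initial stretch are
  -- covered by `K`; a later start has square at most `ε / 2 * (t + 1)`, and `t + 1 ≤ n`.
  have hbound : ∀ n : ℕ, ((ageBefore y n : ℝ) + waitTime y n) ^ 2 ≤ K + ε / 2 * n := by
    intro n
    rcases ageBefore_add_waitTime hy n with h1 | ⟨t, ht, h1⟩
    · have : (ageBefore y n : ℝ) + waitTime y n = waitTime y 0 := by exact_mod_cast h1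
      rw [this, hK]
      have : 0 ≤ ε / 2 * n := by positivity
      linarith
    · rw [h1]
      by_cases htN : t < N
      · have h2 : cycleMoment 2 y t ≤ ∑ t ∈ Finset.range N, cycleMoment 2 y t :=
          Finset.single_le_sum (fun t _ => cycleMoment_nonneg 2 y t) (Finset.mem_range.2 htN)
        have : 0 ≤ ε / 2 * n := by positivity
        have : 0 ≤ (waitTime y 0 : ℝ) ^ 2 := by positivity
        linarith
      · have h2 := hN t (by omega)
        rw [div_le_iff₀ (by positivity)] at h2
        have h3 : (t : ℝ) + 1 ≤ n := by exact_mod_cast ht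
        have h4 : ε / 2 * ((t : ℝ) + 1) ≤ ε / 2 * n := by gcongr
        have : 0 ≤ K := by positivity
        linarith
  obtain ⟨M, hM⟩ := eventually_atTop.1
    ((tendsto_const_div_atTop_nhds_zero_nat K).eventually_lt_const (half_pos hε))
  refine ⟨M, fun n hn => ?_⟩
  have hn0 : (0 : ℝ) < n := Nat.cast_pos.2 (by omega)
  have h1 := hM n hn.le
  rw [div_lt_iff₀ hn0] at h1
  rw [Real.dist_0_eq_abs, abs_of_nonneg (by positivity), div_lt_iff₀ hn0]
  linarith [hbound n]

lemma tendsto_sum_slotAge_div (hy : ∀ n, ∃ ℓ, y (n + ℓ) = 1) {c : ℝ}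
    (h : Tendsto (fun n : ℕ => (∑ t ∈ Finset.range n, cycleMoment 2 y t) / n) atTop (𝓝 c)) :
    Tendsto (fun n : ℕ => (∑ t ∈ Finset.range n, (2 * (slotAge y t : ℝ) + 1)) / n) atTop
      (𝓝 c) := by
  have h1 := tendsto_cycle_sq_div hy h
  have h2 : Tendsto (fun n : ℕ => (((ageBefore y n : ℝ) + waitTime y n) ^ 2 -
      (ageBefore y n : ℝ) ^ 2) / n) atTop (𝓝 0) := by
    refine squeeze_zero (fun n => ?_) (fun n => ?_) h1
    · have : (ageBefore y n : ℝ) ^ 2 ≤ ((ageBefore y n : ℝ) + waitTime y n) ^ 2 := by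
        gcongr; simp
      exact div_nonneg (by linarith) (by positivity)
    · gcongr
      have : 0 ≤ (ageBefore y n : ℝ) ^ 2 := by positivity
      linarith
  have h3 := (h.add (tendsto_const_div_atTop_nhds_zero_nat ((waitTime y 0 : ℝ) ^ 2))).sub h2
  rw [add_zero, sub_zero] at h3
  refine h3.congr fun n => ?_
  rw [← add_div, ← sub_div, ← sum_slotAge hy]
  ring

/-- The deliveries partition the time axis: the mean cycle length per slot is `1`. -/
lemma tendsto_sum_cycleMoment_one_div (hy : ∀ n, ∃ ℓ, y (n + ℓ) = 1) {c : ℝ}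
    (h : Tendsto (fun n : ℕ => (∑ t ∈ Finset.range n, cycleMoment 2 y t) / n) atTop (𝓝 c)) :
    Tendsto (fun n : ℕ => (∑ t ∈ Finset.range n, cycleMoment 1 y t) / n) atTop (𝓝 1) := by
  have h1 : Tendsto (fun n : ℕ => (waitTime y n : ℝ) / n) atTop (𝓝 0) := by
    refine squeeze_zero (fun n => by positivity) (fun n => ?_) (tendsto_cycle_sq_div hy h)
    gcongr
    have : waitTime y n ≤ (ageBefore y n + waitTime y n) ^ 2 :=
      (Nat.le_add_left _ _).trans (Nat.le_self_pow two_ne_zero _)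
    exact_mod_cast this
  have h2 := (tendsto_const_nhds (x := (1 : ℝ))).add
    (h1.sub (tendsto_const_div_atTop_nhds_zero_nat (waitTime y 0 : ℝ)))
  rw [sub_zero, add_zero] at h2
  refine h2.congr' ?_
  filter_upwards [eventually_gt_atTop 0] with n hn
  have hn' : (n : ℝ) ≠ 0 := by positivity
  have := sum_cycleMoment_one hy n
  field_simp
  linarith

end Deterministic

/-! ### Area under the continuous-time sawtooth -/

section Area

variable {Δ : ℝ}

lemma fidelityAge_nonneg (hΔ : 0 < Δ) (y : ℕ → ℕ) {u : ℝ} (hu : 0 ≤ u) : 0 ≤ fidelityAge Δ y u := by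
  have h : Δ * ⌊u / Δ⌋₊ ≤ u := by
    have := Nat.floor_le (div_nonneg hu hΔ.le)
    rwa [le_div_iff₀ hΔ, mul_comm] at this
  have : 0 ≤ Δ * slotAge y ⌊u / Δ⌋₊ := by positivity
  unfold fidelityAge
  linarith

lemma fidelityAge_le (hΔ : 0 < Δ) (y : ℕ → ℕ) (u : ℝ) : fidelityAge Δ y u ≤ u := by
  have h : Δ * (slotAge y ⌊u / Δ⌋₊ : ℝ) ≤ Δ * ⌊u / Δ⌋₊ := by
    gcongr
    exact slotAge_le _ _
  unfold fidelityAge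
  linarith

lemma intervalIntegrable_fidelityAge (hΔ : 0 < Δ) (y : ℕ → ℕ) {a b : ℝ} (ha : 0 ≤ a) (hb : 0 ≤ b) :
    IntervalIntegrable (fidelityAge Δ y) volume a b := by
  have hm : Measurable (fidelityAge Δ y) := by
    have h1 : Measurable fun u : ℝ => ⌊u / Δ⌋₊ := Nat.measurable_floor.comp (by fun_prop)
    have h2 : Measurable fun n : ℕ => (slotAge y n : ℝ) := measurable_from_top
    have h3 : Measurable fun n : ℕ => (n : ℝ) := measurable_from_top
    exact (((h2.comp h1).const_mul Δ)).add (measurable_id.sub ((h3.comp h1).const_mul Δ))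
  refine (continuous_id.intervalIntegrable (μ := volume) a b).mono_fun
    hm.aestronglyMeasurable ?_
  refine (ae_restrict_iff' measurableSet_uIoc).2 (ae_of_all _ fun u hu => ?_)
  have hu0 : 0 ≤ u := (le_min ha hb).trans hu.1.le
  simp only [Real.norm_eq_abs, abs_of_nonneg (fidelityAge_nonneg hΔ y hu0), id,
    abs_of_nonneg hu0]
  exact fidelityAge_le hΔ y u

lemma integral_fidelityAge_slot (hΔ : 0 < Δ) (y : ℕ → ℕ) (n : ℕ) :
    ∫ u in (n * Δ)..((n + 1 : ℕ) * Δ), fidelityAge Δ y u =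
      Δ ^ 2 / 2 * (2 * (slotAge y n : ℝ) + 1) := by
  have hle : (n * Δ) ≤ ((n + 1 : ℕ) * Δ) := by push_cast; nlinarith
  have hcongr : ∫ u in (n * Δ)..((n + 1 : ℕ) * Δ), fidelityAge Δ y u =
      ∫ u in (n * Δ)..((n + 1 : ℕ) * Δ), (Δ * slotAge y n - Δ * n + u) := by
    -- The floor jumps at the right endpoint of the slot, so the comparison is made on the open
    -- interval.
    rw [intervalIntegral.integral_of_le hle, intervalIntegral.integral_of_le hle,
      integral_Ioc_eq_integral_Ioo, integral_Ioc_eq_integral_Ioo]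
    refine setIntegral_congr_fun measurableSet_Ioo fun u hu => ?_
    have hfl : ⌊u / Δ⌋₊ = n := by
      rw [Nat.floor_eq_iff (div_nonneg ((by positivity : (0 : ℝ) ≤ n * Δ).trans hu.1.le) hΔ.le),
        le_div_iff₀ hΔ, div_lt_iff₀ hΔ]
      exact ⟨hu.1.le, by simpa using hu.2⟩
    simp only [fidelityAge, hfl]
    ring
  rw [hcongr, intervalIntegral.integral_add (g := fun u => u) intervalIntegrable_const
      (continuous_id.intervalIntegrable _ _),
    intervalIntegral.integral_const, integral_id]
  push_cast
  rw [smul_eq_mul]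
  ring

lemma integral_fidelityAge_slots (hΔ : 0 < Δ) (y : ℕ → ℕ) (n : ℕ) :
    ∫ u in (0 : ℝ)..(n * Δ), fidelityAge Δ y u =
      Δ ^ 2 / 2 * ∑ t ∈ Finset.range n, (2 * (slotAge y t : ℝ) + 1) := by
  rw [Finset.mul_sum, ← Finset.sum_congr rfl fun t _ => integral_fidelityAge_slot hΔ y t]
  rw [intervalIntegral.sum_integral_adjacent_intervals
    (a := fun k : ℕ => (k : ℝ) * Δ) fun k _ =>
    intervalIntegrable_fidelityAge hΔ y (by positivity) (by positivity)]
  simp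

lemma integral_fidelityAge_mono (hΔ : 0 < Δ) (y : ℕ → ℕ) {a b : ℝ} (ha : 0 ≤ a) (hab : a ≤ b) :
    ∫ u in (0 : ℝ)..a, fidelityAge Δ y u ≤ ∫ u in (0 : ℝ)..b, fidelityAge Δ y u := by
  refine intervalIntegral.integral_mono_interval le_rfl ha hab ?_
    (intervalIntegrable_fidelityAge hΔ y le_rfl (ha.trans hab))
  exact (ae_restrict_iff' measurableSet_Ioc).2
    (ae_of_all _ fun u hu => fidelityAge_nonneg hΔ y hu.1.le)

lemma tendsto_average_fidelityAge (hΔ : 0 < Δ) (y : ℕ → ℕ) {c : ℝ}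
    (h : Tendsto (fun n : ℕ => (∑ t ∈ Finset.range n, (2 * (slotAge y t : ℝ) + 1)) / n) atTop
      (𝓝 c)) :
    Tendsto (fun T : ℝ => T⁻¹ * ∫ u in (0 : ℝ)..T, fidelityAge Δ y u) atTop
      (𝓝 (Δ * (c / 2))) := by
  set G : ℕ → ℝ := fun n => ∑ t ∈ Finset.range n, (2 * (slotAge y t : ℝ) + 1) with hG
  have hfl : Tendsto (fun T : ℝ => ⌊T / Δ⌋₊) atTop atTop :=
    tendsto_nat_floor_atTop.comp (tendsto_id.atTop_div_const hΔ)
  have hq := tendsto_natCast_div_add_atTop (1 : ℝ)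
  -- For `nΔ ≤ T ≤ (n + 1)Δ`, the average is at least the area of `n` slots divided by `(n + 1)Δ`,
  -- and at most that of `n + 1` slots divided by `nΔ`.
  have hlow : Tendsto (fun n : ℕ => Δ / 2 * (G n / n * (n / (n + 1)))) atTop
      (𝓝 (Δ * (c / 2))) := by
    have := (h.mul hq).const_mul (Δ / 2)
    rwa [mul_one, div_mul_eq_mul_div, mul_div_assoc] at this
  have hupp : Tendsto (fun n : ℕ => Δ / 2 * (G (n + 1) / (n + 1 : ℕ) * ((n : ℝ) / (n + 1))⁻¹)) atTop
      (𝓝 (Δ * (c / 2))) := by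
    have := (((tendsto_add_atTop_iff_nat 1).2 h).mul (hq.inv₀ one_ne_zero)).const_mul (Δ / 2)
    rwa [inv_one, mul_one, div_mul_eq_mul_div, mul_div_assoc] at this
  have hG0 : ∀ n, 0 ≤ G n := fun n => Finset.sum_nonneg fun t _ => by positivity
  refine tendsto_of_tendsto_of_tendsto_of_le_of_le' (hlow.comp hfl) (hupp.comp hfl) ?_ ?_
  · filter_upwards [hfl.eventually_gt_atTop 0, eventually_gt_atTop 0] with T hn hT
    have hn' : (0 : ℝ) < ⌊T / Δ⌋₊ := Nat.cast_pos.2 hn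
    have h1 : (⌊T / Δ⌋₊ : ℝ) * Δ ≤ T := (le_div_iff₀ hΔ).1 (Nat.floor_le (by positivity))
    have h2 : T ≤ (⌊T / Δ⌋₊ + 1 : ℝ) * Δ := ((div_lt_iff₀ hΔ).1 (Nat.lt_floor_add_one _)).le
    have h3 := integral_fidelityAge_mono hΔ y (by positivity) h1
    rw [integral_fidelityAge_slots hΔ] at h3
    refine le_trans (le_of_eq ?_) (mul_le_mul (inv_anti₀ hT h2) h3
      (mul_nonneg (by positivity) (hG0 _)) (by positivity))
    simp only [Function.comp, hG]
    field_simp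
  · filter_upwards [hfl.eventually_gt_atTop 0, eventually_gt_atTop 0] with T hn hT
    have hn' : (0 : ℝ) < ⌊T / Δ⌋₊ := Nat.cast_pos.2 hn
    have h1 : (⌊T / Δ⌋₊ : ℝ) * Δ ≤ T := (le_div_iff₀ hΔ).1 (Nat.floor_le (by positivity))
    have h2 : T ≤ ((⌊T / Δ⌋₊ + 1 : ℕ) : ℝ) * Δ := by
      push_cast
      exact ((div_lt_iff₀ hΔ).1 (Nat.lt_floor_add_one _)).le
    have h3 := integral_fidelityAge_mono hΔ y hT.le h2
    rw [integral_fidelityAge_slots hΔ] at h3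
    refine le_trans (mul_le_mul (inv_anti₀ (by positivity) h1) h3 ?_ (by positivity))
      (le_of_eq ?_)
    · exact intervalIntegral.integral_nonneg hT.le fun u hu => fidelityAge_nonneg hΔ y hu.1
    · simp only [Function.comp, hG]
      push_cast
      field_simp

end Area

/-! ### Kac's formula and the renewal identity on path space -/

section Renewal

/-- The shift on the path space. -/
def shift {S : Type*} (z : ℕ → S) (t : ℕ) : S := z (t + 1)

lemma shift_iterate {S : Type*} (n : ℕ) (z : ℕ → S) (t : ℕ) : shift^[n] z t = z (t + n) := by
  induction n generalizing z with
  | zero => rfl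
  | succ n ih => rw [Function.iterate_succ_apply, ih]; rfl

lemma interDelivery_shift (n : ℕ) (y : ℕ → ℕ) :
    interDelivery (shift^[n] y) 0 = interDelivery y n := by
  unfold interDelivery
  simp only [shift_iterate, zero_add, add_comm n]

lemma cycleMoment_shift (k n : ℕ) (y : ℕ → ℕ) :
    cycleMoment k (shift^[n] y) 0 = cycleMoment k y n := by
  unfold cycleMoment
  rw [interDelivery_shift, shift_iterate, zero_add]

lemma measurableSet_eval_eq_one (t : ℕ) : MeasurableSet {y : ℕ → ℕ | y t = 1} :=
  measurableSet_eq_fun (measurable_pi_apply t) measurable_const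

lemma measurable_interDelivery (t : ℕ) :
    Measurable fun y : ℕ → ℕ => (interDelivery y t : ℝ≥0∞) := by
  simp only [interDelivery, ENat.toENNReal_iInf]
  refine Measurable.iInf fun ℓ => ?_
  have h : (fun y : ℕ → ℕ => ⨅ _ : ℓ ∈ {ℓ : ℕ | 1 ≤ ℓ ∧ y (t + ℓ) = 1}, ((ℓ : ℕ∞) : ℝ≥0∞)) =
      fun y => if 1 ≤ ℓ ∧ y (t + ℓ) = 1 then ((ℓ : ℕ∞) : ℝ≥0∞) else ⊤ := by
    ext y
    rw [iInf_eq_if]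
    rfl
  rw [h]
  exact Measurable.ite ((MeasurableSet.const _).inter (measurableSet_eval_eq_one _))
    measurable_const measurable_const

lemma cycleMoment_eq (k : ℕ) (y : ℕ → ℕ) (t : ℕ) :
    cycleMoment k y t = {y : ℕ → ℕ | y t = 1}.indicator
      (fun y => ((interDelivery y t : ℝ≥0∞).toReal) ^ k) y := by
  have : (interDelivery y t : ℝ≥0∞).toReal = ((interDelivery y t).toNat : ℝ) := by
    cases interDelivery y t <;> simp
  rw [Set.indicator_apply, this]
  rfl

lemma measurable_cycleMoment (k t : ℕ) : Measurable fun y : ℕ → ℕ => cycleMoment k y t := by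
  simp only [cycleMoment_eq]
  exact (((measurable_interDelivery t).ennreal_toReal).pow_const k).indicator
    (measurableSet_eval_eq_one t)

lemma birkhoffSum_cycleMoment (k n : ℕ) (y : ℕ → ℕ) :
    birkhoffSum shift (fun y => cycleMoment k y 0) n y =
      ∑ t ∈ Finset.range n, cycleMoment k y t := by
  simp only [birkhoffSum, cycleMoment_shift]

variable {μ : Measure (ℕ → ℕ)} [IsProbabilityMeasure μ]

/-- Having infinitely many deliveries is shift-invariant, so it has probability `0` or `1`. Poincaré
recurrence makes it hold almost surely on the non-null event of a delivery in slot `0`, which rules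
out `0`. -/
lemma ae_forall_exists_delivery (hμ : Ergodic shift μ) (hpos : 0 < μ {y | y 0 = 1}) :
    ∀ᵐ y ∂μ, ∀ n, ∃ ℓ, y (n + ℓ) = 1 := by
  set D : Set (ℕ → ℕ) := {y | ∀ n, ∃ ℓ, y (n + ℓ) = 1} with hD
  have hDm : MeasurableSet D := by
    have : D = ⋂ n, ⋃ ℓ, {y | y (n + ℓ) = 1} := by ext; simp [hD]
    rw [this]
    exact .iInter fun n => .iUnion fun ℓ => measurableSet_eval_eq_one _
  have hinv : shift ⁻¹' D = D := by
    ext y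
    constructor
    · intro h n
      obtain ⟨ℓ, hℓ⟩ := h n
      exact ⟨ℓ + 1, hℓ⟩
    · intro h n
      obtain ⟨ℓ, hℓ⟩ := h (n + 1)
      exact ⟨ℓ, by rw [← hℓ, shift]; congr 1; omega⟩
  refine (hμ.toPreErgodic.ae_mem_or_ae_notMem hDm hinv).resolve_right fun h => ?_
  have hrec := hμ.toMeasurePreserving.conservative.ae_mem_imp_frequently_image_mem
    (measurableSet_eval_eq_one 0).nullMeasurableSet
  refine hpos.ne' (measure_mono_null ?_ (ae_iff.1 (h.and hrec)))
  rintro y (hy : y 0 = 1) ⟨hyD, hyr⟩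
  refine hyD fun n => ?_
  obtain ⟨m, hm, hym⟩ := frequently_atTop.1 (hyr hy) n
  refine ⟨m - n, ?_⟩
  have : shift^[m] y 0 = 1 := hym
  rwa [shift_iterate, zero_add, show m = n + (m - n) by omega] at this

/-- Deliveries recur almost surely, so sending an infinite inter-delivery time to `0` loses nothing.
-/
lemma integral_cycleMoment (hμ : Ergodic shift μ) (hpos : 0 < μ {y | y 0 = 1}) (k : ℕ)
    (hfin : ∫⁻ y in {y | y 0 = 1}, (interDelivery y 0 : ℝ≥0∞) ^ k ∂μ < ∞) :
    Integrable (fun y => cycleMoment k y 0) μ ∧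
      ∫ y, cycleMoment k y 0 ∂μ =
        (∫⁻ y in {y | y 0 = 1}, (interDelivery y 0 : ℝ≥0∞) ^ k ∂μ).toReal := by
  have hlint : ∫⁻ y, ENNReal.ofReal (cycleMoment k y 0) ∂μ =
      ∫⁻ y in {y | y 0 = 1}, (interDelivery y 0 : ℝ≥0∞) ^ k ∂μ := by
    rw [← lintegral_indicator (measurableSet_eval_eq_one 0)]
    refine lintegral_congr_ae ?_
    filter_upwards [ae_forall_exists_delivery hμ hpos] with y hy
    rw [cycleMoment_eq]
    by_cases h : y 0 = 1
    · rw [Set.indicator_of_mem (by exact h), Set.indicator_of_mem (by exact h),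
        ENNReal.ofReal_pow ENNReal.toReal_nonneg, ENNReal.ofReal_toReal]
      rw [interDelivery_eq_waitTime hy]
      simp
    · rw [Set.indicator_of_notMem (by exact h), Set.indicator_of_notMem (by exact h)]
      simp
  have hnn : 0 ≤ᵐ[μ] fun y => cycleMoment k y 0 := ae_of_all _ fun y => cycleMoment_nonneg k y 0
  have hm := (measurable_cycleMoment k 0).aestronglyMeasurable (μ := μ)
  refine ⟨⟨hm, ?_⟩, ?_⟩
  · rw [hasFiniteIntegral_iff_ofReal hnn, hlint]
    exact hfin
  · rw [integral_eq_lintegral_of_nonneg_ae hnn hm, hlint]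

lemma ae_tendsto_average_fidelityAge (hμ : Ergodic shift μ) (hpos : 0 < μ {y | y 0 = 1})
    (hfin₁ : ∫⁻ y in {y | y 0 = 1}, (interDelivery y 0 : ℝ≥0∞) ^ 1 ∂μ < ∞)
    (hfin₂ : ∫⁻ y in {y | y 0 = 1}, (interDelivery y 0 : ℝ≥0∞) ^ 2 ∂μ < ∞)
    {Δ : ℝ} (hΔ : 0 < Δ) :
    (∫⁻ y in {y | y 0 = 1}, (interDelivery y 0 : ℝ≥0∞) ^ 1 ∂μ).toReal = 1 ∧
    ∀ᵐ y ∂μ, Tendsto (fun T : ℝ => T⁻¹ * ∫ u in (0 : ℝ)..T, fidelityAge Δ y u) atTop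
      (𝓝 (Δ * ((∫⁻ y in {y | y 0 = 1}, (interDelivery y 0 : ℝ≥0∞) ^ 2 ∂μ).toReal / 2))) := by
  obtain ⟨hi₁, he₁⟩ := integral_cycleMoment hμ hpos 1 hfin₁
  obtain ⟨hi₂, he₂⟩ := integral_cycleMoment hμ hpos 2 hfin₂
  have h₁ := ae_tendsto_birkhoffSum_div hμ (measurable_cycleMoment 1 0) hi₁
  have h₂ := ae_tendsto_birkhoffSum_div hμ (measurable_cycleMoment 2 0) hi₂
  have hy := ae_forall_exists_delivery hμ hpos
  simp only [birkhoffSum_cycleMoment, he₁, he₂] at h₁ h₂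
  constructor
  -- Kac's formula from one typical path: the ergodic average and the tiling of time give the same
  -- limit.
  · obtain ⟨y, h₁, h₂, hy⟩ := (h₁.and (h₂.and hy)).exists
    exact tendsto_nhds_unique h₁ (tendsto_sum_cycleMoment_one_div hy h₂)
  · filter_upwards [h₂, hy] with y h₂ hy
    exact tendsto_average_fidelityAge hΔ y (tendsto_sum_slotAge_div hy h₂)

/-- The renewal identity for a stationary and ergodic sequence of delivery indicators. -/
theorem ae_tendsto_average_fidelityAge_of_isStationaryErgodic {Ω : Type*} [MeasurableSpace Ω]
    {P : Measure Ω} [IsProbabilityMeasure P] {Y : ℕ → Ω → ℕ} (hYm : ∀ t, Measurable (Y t))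
    (hY : IsStationaryErgodic P Y) {t : ℕ} (hpos : 0 < P {ω | Y t ω = 1})
    (hfin₁ : ∫⁻ ω, (interDelivery (fun r => Y r ω) t : ℝ≥0∞) ∂P[|{ω | Y t ω = 1}] < ∞)
    (hfin₂ : ∫⁻ ω, (interDelivery (fun r => Y r ω) t : ℝ≥0∞) ^ 2 ∂P[|{ω | Y t ω = 1}] < ∞)
    {Δ : ℝ} (hΔ : 0 < Δ) :
    ∀ᵐ ω ∂P, Tendsto
      (fun T : ℝ => T⁻¹ * ∫ u in (0 : ℝ)..T, fidelityAge Δ (fun r => Y r ω) u) atTop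
      (𝓝 (Δ * ((∫⁻ ω, (interDelivery (fun r => Y r ω) t : ℝ≥0∞) ^ 2
          ∂P[|{ω | Y t ω = 1}]).toReal /
        (2 * (∫⁻ ω, (interDelivery (fun r => Y r ω) t : ℝ≥0∞)
          ∂P[|{ω | Y t ω = 1}]).toReal)))) := by
  have hm : Measurable fun ω t => Y t ω := measurable_pi_lambda _ hYm
  set μ := P.map fun ω t => Y t ω with hμdef
  have : IsProbabilityMeasure μ := Measure.isProbabilityMeasure_map hm.aemeasurable
  have hμ : Ergodic shift μ := hY
  -- By stationarity, conditioning on a delivery in slot `t` can be moved to slot `0`.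
  have hψ : MeasurePreserving (fun ω => shift^[t] fun r => Y r ω) P μ :=
    (hμ.toMeasurePreserving.iterate t).comp ⟨hm, rfl⟩
  have hset : (fun ω => shift^[t] fun r => Y r ω) ⁻¹' {y | y 0 = 1} = {ω | Y t ω = 1} := by
    ext ω
    simp [shift_iterate]
  have hmeas : μ {y | y 0 = 1} = P {ω | Y t ω = 1} := by
    rw [← hset, hψ.measure_preimage (measurableSet_eval_eq_one 0).nullMeasurableSet]
  have hint : ∀ k : ℕ, ∫⁻ y in {y | y 0 = 1}, (interDelivery y 0 : ℝ≥0∞) ^ k ∂μ =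
      P {ω | Y t ω = 1} * ∫⁻ ω, (interDelivery (fun r => Y r ω) t : ℝ≥0∞) ^ k
        ∂P[|{ω | Y t ω = 1}] := by
    intro k
    rw [ProbabilityTheory.cond, lintegral_smul_measure, smul_eq_mul, ← mul_assoc,
      ENNReal.mul_inv_cancel hpos.ne' (measure_ne_top _ _), one_mul, ← hset,
      ← hψ.setLIntegral_comp_preimage (measurableSet_eval_eq_one 0)
        ((measurable_interDelivery 0).pow_const k)]
    simp only [interDelivery_shift]
  have hint₁ := hint 1
  have hint₂ := hint 2
  simp only [pow_one] at hint₁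
  have hP := measure_lt_top P {ω | Y t ω = 1}
  have key := ae_tendsto_average_fidelityAge hμ (hmeas ▸ hpos)
    (by simpa only [pow_one, hint₁] using ENNReal.mul_lt_top hP hfin₁)
    (by simpa only [hint₂] using ENNReal.mul_lt_top hP hfin₂) hΔ
  simp only [pow_one, hint₁, hint₂, ENNReal.toReal_mul] at key
  obtain ⟨h₁, h₂⟩ := key
  have h₃ := ae_of_ae_map hm.aemeasurable h₂
  filter_upwards [h₃] with ω hω
  convert hω using 3
  set a := (P {ω | Y t ω = 1}).toReal
  set b := (∫⁻ ω, (interDelivery (fun r => Y r ω) t : ℝ≥0∞) ∂P[|{ω | Y t ω = 1}]).toReal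
  have hb : b ≠ 0 := right_ne_zero_of_mul_eq_one h₁
  -- Kac's formula `a * b = 1` replaces the delivery probability by the inverse mean cycle length.
  rw [eq_inv_of_mul_eq_one_left h₁]
  field_simp

end Renewal

/-! ### Moments of the geometric law -/

section Geometric

lemma hasSum_succ_mul_geometric {p : ℝ} (hp : 0 < p) (hp1 : p ≤ 1) :
    HasSum (fun k : ℕ => ((k + 1 : ℕ) : ℝ) * ((1 - p) ^ k * p)) (1 / p) := by
  have hr : ‖1 - p‖ < 1 := by rw [Real.norm_eq_abs, abs_lt]; constructor <;> linarith
  have h := (hasSum_choose_mul_geometric_of_norm_lt_one 1 hr).mul_right p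
  rw [sub_sub_cancel] at h
  have hs : 1 / p = 1 / p ^ (1 + 1) * p := by field_simp
  have hf : (fun k : ℕ => ((k + 1 : ℕ) : ℝ) * ((1 - p) ^ k * p)) =
      fun k : ℕ => ((k + 1).choose 1 : ℝ) * (1 - p) ^ k * p := by
    ext k
    rw [Nat.choose_one_right]
    ring
  rw [hs, hf]
  exact h

/-- Uses `(k + 1)² = 2 * (k + 2).choose 2 - (k + 1)` and the negative binomial series. -/
lemma hasSum_succ_sq_mul_geometric {p : ℝ} (hp : 0 < p) (hp1 : p ≤ 1) :
    HasSum (fun k : ℕ => ((k + 1 : ℕ) : ℝ) ^ 2 * ((1 - p) ^ k * p)) ((2 - p) / p ^ 2) := by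
  have hr : ‖1 - p‖ < 1 := by rw [Real.norm_eq_abs, abs_lt]; constructor <;> linarith
  have h := ((hasSum_choose_mul_geometric_of_norm_lt_one 2 hr).mul_right (2 * p)).sub
    (hasSum_succ_mul_geometric hp hp1)
  rw [sub_sub_cancel] at h
  have hs : (2 - p) / p ^ 2 = 1 / p ^ (2 + 1) * (2 * p) - 1 / p := by
    field_simp
    ring
  have hf : (fun k : ℕ => ((k + 1 : ℕ) : ℝ) ^ 2 * ((1 - p) ^ k * p)) =
      fun k : ℕ => ((k + 2).choose 2 : ℝ) * (1 - p) ^ k * (2 * p) -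
        ((k + 1 : ℕ) : ℝ) * ((1 - p) ^ k * p) := by
    ext k
    rw [Nat.cast_choose_two]
    push_cast
    ring
  rw [hs, hf]
  exact h

/-- The prescribed masses add up to `1`, which excludes the value `∞` and every other value almost
surely. -/
lemma lintegral_pow_of_geometric {Ω : Type*} [MeasurableSpace Ω] {μ : Measure Ω}
    [IsProbabilityMeasure μ] {τ : Ω → ℝ≥0∞} (hτ : Measurable τ) {p : ℝ} (hp : 0 < p) (hp1 : p ≤ 1)
    (hgeom : ∀ k : ℕ, μ {ω | τ ω = ((k + 1 : ℕ) : ℝ≥0∞)} = ENNReal.ofReal ((1 - p) ^ k * p))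
    {j : ℕ} {c : ℝ} (hc : HasSum (fun k : ℕ => ((k + 1 : ℕ) : ℝ) ^ j * ((1 - p) ^ k * p)) c) :
    ∫⁻ ω, τ ω ^ j ∂μ = ENNReal.ofReal c := by
  set D : ℕ → Set Ω := fun k => {ω | τ ω = ((k + 1 : ℕ) : ℝ≥0∞)} with hD
  have hDm : ∀ k, MeasurableSet (D k) := fun k => measurableSet_eq_fun hτ measurable_const
  have hdisj : Pairwise (Function.onFun Disjoint D) := by
    intro k l hkl
    refine Set.disjoint_left.2 fun ω hk hl => hkl ?_
    have h : ((k + 1 : ℕ) : ℝ≥0∞) = ((l + 1 : ℕ) : ℝ≥0∞) := hk.symm.trans hl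
    have := Nat.cast_injective h
    omega
  have hp0 : 0 ≤ 1 - p := by linarith
  have hsum : μ (⋃ k, D k) = 1 := by
    rw [measure_iUnion hdisj hDm]
    simp only [hD, hgeom]
    have h := (hasSum_geometric_of_lt_one hp0 (by linarith)).mul_right p
    rw [sub_sub_cancel, inv_mul_cancel₀ hp.ne'] at h
    rw [← ENNReal.ofReal_tsum_of_nonneg (fun k => by positivity) h.summable, h.tsum_eq,
      ENNReal.ofReal_one]
  have hae : (⋃ k, D k : Set Ω) =ᵐ[μ] Set.univ :=
    ae_eq_univ_iff_measure_eq (MeasurableSet.iUnion hDm).nullMeasurableSet |>.2 (by simp [hsum])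
  rw [← setLIntegral_univ, ← setLIntegral_congr hae, lintegral_iUnion hDm hdisj, ← hc.tsum_eq,
    ENNReal.ofReal_tsum_of_nonneg (fun k => by positivity) hc.summable]
  refine tsum_congr fun k => ?_
  rw [setLIntegral_congr_fun (g := fun _ => ((k + 1 : ℕ) : ℝ≥0∞) ^ j) (hDm k)
    (fun ω (hω : τ ω = _) => by simp only [hω]), setLIntegral_const, hgeom,
    ENNReal.ofReal_mul (p := ((k + 1 : ℕ) : ℝ) ^ j) (by positivity),
    ENNReal.ofReal_pow (by positivity), ENNReal.ofReal_natCast]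

end Geometric

/-! ### Ergodicity of systems driven by i.i.d. inputs -/

section SkewProduct

variable {S X : Type*} [MeasurableSpace S] [MeasurableSpace X]

lemma measurable_shift {S : Type*} [MeasurableSpace S] :
    Measurable (shift : (ℕ → S) → ℕ → S) :=
  measurable_pi_lambda _ fun _ => measurable_pi_apply _

lemma map_shift_iterate_infinitePi (ν : Measure X) [IsProbabilityMeasure ν] (n : ℕ) :
    (Measure.infinitePi fun _ : ℕ => ν).map shift^[n] = Measure.infinitePi fun _ : ℕ => ν := by
  have : (shift^[n] : (ℕ → X) → ℕ → X) = fun x t => x (t + n) := by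
    ext x t
    exact shift_iterate n x t
  rw [this]
  exact Measure.map_infinitePi_infinitePi_of_inj (P := fun _ : ℕ => ν) (add_left_injective n)

/-- The first `n` terms of a sequence. -/
def initialTerms (n : ℕ) (x : ℕ → X) (i : Fin n) : X := x i

lemma measurable_initialTerms (n : ℕ) : Measurable (initialTerms n : (ℕ → X) → Fin n → X) :=
  measurable_pi_lambda _ fun _ => measurable_pi_apply _

lemma indepFun_initialTerms_shift (ν : Measure X) [IsProbabilityMeasure ν] (n : ℕ) :
    IndepFun (initialTerms n) shift^[n] (Measure.infinitePi fun _ : ℕ => ν) := by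
  have hind : iIndep (fun i : ℕ => MeasurableSpace.comap (fun x : ℕ → X => x i) inferInstance)
      (Measure.infinitePi fun _ : ℕ => ν) :=
    iIndepFun_infinitePi (P := fun _ : ℕ => ν) (X := fun _ x => x) fun _ => measurable_id
  have h := indep_iSup_of_disjoint (fun i => (measurable_pi_apply i).comap_le) hind
    (S := {i | i < n}) (T := {i | n ≤ i})
    (Set.disjoint_left.2 fun i (hi : i < n) (hi' : n ≤ i) => by omega)
  refine indep_of_indep_of_le_left (indep_of_indep_of_le_right h ?_) ?_
  · refine Measurable.comap_le ?_
    refine @measurable_pi_lambda _ _ _ (_) _ _ fun t => ?_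
    simp only [shift_iterate]
    exact (comap_measurable (fun x : ℕ → X => x (t + n))).mono
      (le_iSup₂_of_le (t + n) (Nat.le_add_left n t) le_rfl) le_rfl
  · refine Measurable.comap_le ?_
    refine @measurable_pi_lambda _ _ _ (_) _ _ fun i => ?_
    exact (comap_measurable (fun x : ℕ → X => x i)).mono
      (le_iSup₂_of_le (i : ℕ) i.2 le_rfl) le_rfl

/-- One step of a system with state in `S` that is driven by a sequence of inputs in `X`. -/
def skewShift (F : S × X → S) (p : S × (ℕ → X)) : S × (ℕ → X) := (F (p.1, p.2 0), shift p.2)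

lemma skewShift_iterate_snd {S X : Type*} (F : S × X → S) (n : ℕ) (p : S × (ℕ → X)) :
    ((skewShift F)^[n] p).2 = shift^[n] p.2 := by
  induction n generalizing p with
  | zero => rfl
  | succ n ih => rw [Function.iterate_succ_apply, Function.iterate_succ_apply, ih]; rfl

lemma measurable_skewShift {F : S × X → S} (hF : Measurable F) : Measurable (skewShift F) :=
  (hF.comp (measurable_fst.prodMk ((measurable_pi_apply 0).comp measurable_snd))).prodMk
    (measurable_shift.comp measurable_snd)

/-- The information in the initial state and the first `n` inputs. -/
def inputFiltration (S X : Type*) [MeasurableSpace S] [MeasurableSpace X] :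
    Filtration ℕ (inferInstance : MeasurableSpace (S × (ℕ → X))) where
  seq n := MeasurableSpace.comap (fun p => (p.1, initialTerms n p.2)) inferInstance
  mono' := by
    intro m n hmn
    refine Measurable.comap_le ?_
    have h : Measurable fun q : S × (Fin n → X) => (q.1, fun i : Fin m => q.2 (Fin.castLE hmn i)) :=
      measurable_fst.prodMk
        (measurable_pi_lambda _ fun i => (measurable_pi_apply _).comp measurable_snd)
    exact h.comp (comap_measurable fun p : S × (ℕ → X) => (p.1, initialTerms n p.2))
  le' n := (measurable_fst.prodMk
    ((measurable_initialTerms n).comp measurable_snd)).comap_le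

lemma measurable_initialTerms_inputFiltration (n : ℕ) :
    Measurable[inputFiltration S X n] (fun p : S × (ℕ → X) => (p.1, initialTerms n p.2)) :=
  comap_measurable _

lemma measurable_fst_inputFiltration (n : ℕ) :
    Measurable[inputFiltration S X n] (Prod.fst : S × (ℕ → X) → S) :=
  (measurable_fst (α := S) (β := Fin n → X)).comp (measurable_initialTerms_inputFiltration n)

lemma measurable_input_inputFiltration {i n : ℕ} (h : i < n) :
    Measurable[inputFiltration S X n] (fun p : S × (ℕ → X) => p.2 i) :=
  ((measurable_pi_apply (⟨i, h⟩ : Fin n)).comp measurable_snd).comp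
    (measurable_initialTerms_inputFiltration n)

/-- Every input is eventually revealed, so Lévy's theorem recovers the event itself in the limit. -/
lemma iSup_inputFiltration :
    ⨆ n, inputFiltration S X n = (inferInstance : MeasurableSpace (S × (ℕ → X))) := by
  refine le_antisymm (iSup_le fun n => (inputFiltration S X).le n) ?_
  refine sup_le ?_ ?_
  · exact ((measurable_fst_inputFiltration 0).mono (le_iSup _ 0) le_rfl).comap_le
  · refine Measurable.comap_le ?_
    refine @measurable_pi_lambda _ _ _ (_) _ _ fun i => ?_
    exact (measurable_input_inputFiltration (Nat.lt_succ_self i)).mono (le_iSup _ (i + 1)) le_rfl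

lemma measurable_skewShift_iterate_fst {F : S × X → S} (hF : Measurable F) (n : ℕ) :
    Measurable[inputFiltration S X n] fun p => ((skewShift F)^[n] p).1 := by
  induction n with
  | zero => exact measurable_fst_inputFiltration 0
  | succ n ih =>
    have e : (fun p => ((skewShift F)^[n + 1] p).1) =
        fun p : S × (ℕ → X) => F (((skewShift F)^[n] p).1, p.2 n) := by
      ext p
      rw [Function.iterate_succ_apply', skewShift, skewShift_iterate_snd, shift_iterate, zero_add]
    rw [e]
    exact hF.comp (Measurable.prodMk (m := inputFiltration S X (n + 1))
      (ih.mono ((inputFiltration S X).mono n.le_succ) le_rfl)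
      (measurable_input_inputFiltration n.lt_succ_self))

variable (μ : Measure S) [IsProbabilityMeasure μ] (ν : Measure X) [IsProbabilityMeasure ν]

/-- The law of an initial state and an independent i.i.d. sequence of inputs. -/
noncomputable abbrev inputLaw : Measure (S × (ℕ → X)) :=
  μ.prod (Measure.infinitePi fun _ : ℕ => ν)

lemma map_shift_iterate_snd_inputLaw (n : ℕ) :
    (inputLaw μ ν).map (fun p => shift^[n] p.2) = Measure.infinitePi fun _ : ℕ => ν := by
  have hs : Measurable (shift^[n] : (ℕ → X) → ℕ → X) := measurable_shift.iterate n
  have : (fun p : S × (ℕ → X) => shift^[n] p.2) = shift^[n] ∘ Prod.snd := rfl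
  rw [this, ← Measure.map_map hs measurable_snd, Measure.map_snd_prod, measure_univ, one_smul,
    map_shift_iterate_infinitePi]

lemma indep_inputFiltration_shift (n : ℕ) :
    Indep (inputFiltration S X n)
      (MeasurableSpace.comap (fun p : S × (ℕ → X) => shift^[n] p.2) inferInstance)
      (inputLaw μ ν) := by
  have hs : Measurable (shift^[n] : (ℕ → X) → ℕ → X) := measurable_shift.iterate n
  have hi := measurable_initialTerms (X := X) n
  have hU : Measurable fun p : S × (ℕ → X) => (p.1, initialTerms n p.2) :=
    measurable_fst.prodMk (hi.comp measurable_snd)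
  have hV : Measurable fun p : S × (ℕ → X) => shift^[n] p.2 := hs.comp measurable_snd
  suffices h : IndepFun (fun p : S × (ℕ → X) => (p.1, initialTerms n p.2))
      (fun p => shift^[n] p.2) (inputLaw μ ν) from h
  rw [indepFun_iff_map_prod_eq_prod_map_map hU.aemeasurable hV.aemeasurable,
    map_shift_iterate_snd_inputLaw]
  set ρ := Measure.infinitePi fun _ : ℕ => ν with hρ
  have hiρ : IsProbabilityMeasure (ρ.map (initialTerms n)) :=
    Measure.isProbabilityMeasure_map hi.aemeasurable
  have h1 : ρ.map (fun x => (initialTerms n x, shift^[n] x)) = (ρ.map (initialTerms n)).prod ρ := by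
    rw [(indepFun_iff_map_prod_eq_prod_map_map hi.aemeasurable hs.aemeasurable).1
      (indepFun_initialTerms_shift ν n), map_shift_iterate_infinitePi]
  have h2 : (inputLaw μ ν).map (fun p => (p.1, initialTerms n p.2)) =
      μ.prod (ρ.map (initialTerms n)) := by
    have := Measure.map_prod_map μ ρ measurable_id hi
    rw [Measure.map_id] at this
    exact this.symm
  have h3 : (inputLaw μ ν).map (fun p => (p.1, (initialTerms n p.2, shift^[n] p.2))) =
      μ.prod ((ρ.map (initialTerms n)).prod ρ) := by
    have := Measure.map_prod_map μ ρ measurable_id (hi.prodMk hs)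
    rw [Measure.map_id, h1] at this
    exact this.symm
  have h4 : (fun p : S × (ℕ → X) => ((p.1, initialTerms n p.2), shift^[n] p.2)) =
      MeasurableEquiv.prodAssoc.symm ∘ fun p => (p.1, (initialTerms n p.2, shift^[n] p.2)) := rfl
  have h5 : Measurable fun p : S × (ℕ → X) => (p.1, (initialTerms n p.2, shift^[n] p.2)) :=
    measurable_fst.prodMk ((hi.prodMk hs).comp measurable_snd)
  rw [h2, h4, ← Measure.map_map (MeasurableEquiv.measurable _) h5, h3,
    (measurePreserving_prodAssoc _ _ _).symm.map_eq]

/-- A function of the first `n` inputs and the initial state is independent of the later inputs. -/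
lemma map_prod_shift_inputLaw {β : Type*} [MeasurableSpace β] {W : S × (ℕ → X) → β} {n : ℕ}
    (hW : Measurable[inputFiltration S X n] W) :
    (inputLaw μ ν).map (fun p => (W p, shift^[n] p.2)) =
      ((inputLaw μ ν).map W).prod (Measure.infinitePi fun _ : ℕ => ν) := by
  have hind : IndepFun W (fun p => shift^[n] p.2) (inputLaw μ ν) :=
    indep_of_indep_of_le_left (indep_inputFiltration_shift μ ν n) hW.comap_le
  have hV : Measurable fun p : S × (ℕ → X) => shift^[n] p.2 :=
    (measurable_shift.iterate n).comp measurable_snd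
  rw [(indepFun_iff_map_prod_eq_prod_map_map
    (hW.mono ((inputFiltration S X).le n) le_rfl).aemeasurable hV.aemeasurable).1 hind,
    map_shift_iterate_snd_inputLaw]

/-- The state after one step is independent of the remaining inputs, which are again i.i.d.; only
the marginal law of the state needs to be checked. -/
lemma measurePreserving_skewShift {F : S × X → S} (hF : Measurable F)
    (hμ : (inputLaw μ ν).map (fun p => (skewShift F p).1) = μ) :
    MeasurePreserving (skewShift F) (inputLaw μ ν) (inputLaw μ ν) := by
  refine ⟨measurable_skewShift hF, ?_⟩
  have h := map_prod_shift_inputLaw μ ν (measurable_skewShift_iterate_fst hF 1)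
  simp only [Function.iterate_one, hμ] at h
  exact h

variable {F : S × X → S} {E : Set (S × (ℕ → X))}

/-- Conditional probability of an invariant event, given the state and past inputs. -/
lemma condExp_indicator_invariant (hF : Measurable F) (hE : MeasurableSet E)
    (hinv : skewShift F ⁻¹' E = E) (n : ℕ) :
    (fun p => ((Measure.infinitePi fun _ : ℕ => ν)
      (Prod.mk ((skewShift F)^[n] p).1 ⁻¹' E)).toReal) =ᵐ[inputLaw μ ν]
      (inputLaw μ ν)[E.indicator fun _ => (1 : ℝ) | inputFiltration S X n] := by
  set ρ := Measure.infinitePi fun _ : ℕ => ν with hρ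
  have hle := (inputFiltration S X).le n
  have hs := measurable_skewShift_iterate_fst (X := X) hF n
  have hh : Measurable fun s : S => (ρ (Prod.mk s ⁻¹' E)) := measurable_measure_prodMk_left hE
  have hg : Measurable[inputFiltration S X n]
      fun p => (ρ (Prod.mk ((skewShift F)^[n] p).1 ⁻¹' E)).toReal := (hh.comp hs).ennreal_toReal
  have hgi : Integrable (fun p => (ρ (Prod.mk ((skewShift F)^[n] p).1 ⁻¹' E)).toReal)
      (inputLaw μ ν) := by
    refine Integrable.of_bound (hg.mono hle le_rfl).aestronglyMeasurable 1 (ae_of_all _ fun p => ?_)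
    rw [Real.norm_eq_abs, abs_of_nonneg ENNReal.toReal_nonneg]
    exact ENNReal.toReal_mono ENNReal.one_ne_top prob_le_one
  refine ae_eq_condExp_of_forall_setIntegral_eq hle
    ((integrable_const (1 : ℝ)).indicator hE) (fun _ _ _ => hgi.integrableOn) ?_
    hg.aestronglyMeasurable
  intro A hA _
  have hA' := hle A hA
  have hiter : (skewShift F)^[n] ⁻¹' E = E := by
    have h := Function.IsFixedPt.iterate (f := Set.preimage (skewShift F)) hinv n
    rwa [← Set.preimage_iterate_eq] at h
  -- Membership in `A` is carried along as a coordinate. By invariance, `A ∩ E` depends on past data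
  -- and the later inputs only through this pair and the shifted inputs, so Fubini applies.
  have hW : Measurable[inputFiltration S X n] fun p => (((skewShift F)^[n] p).1, p ∈ A) :=
    Measurable.prodMk (m := inputFiltration S X n) hs
      ((@measurableSet_setOfPred _ (inputFiltration S X n) (fun p => p ∈ A)).1 hA)
  set R : Set ((S × Prop) × (ℕ → X)) := {q | q.1.2 ∧ (q.1.1, q.2) ∈ E} with hR
  have hRm : MeasurableSet R :=
    (measurableSet_setOfPred.2 (measurable_snd.comp measurable_fst)).inter
      (((measurable_fst.comp measurable_fst).prodMk measurable_snd) hE)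
  have hAE : A ∩ E = (fun p => ((((skewShift F)^[n] p).1, p ∈ A), shift^[n] p.2)) ⁻¹' R := by
    ext p
    have : p ∈ E ↔ (skewShift F)^[n] p ∈ E := by
      conv_lhs => rw [← hiter]
      rfl
    rw [Set.mem_inter_iff, this]
    simp only [Set.mem_preimage, hR, ← skewShift_iterate_snd F n p]
    rfl
  have hsm : Measurable fun p : S × (ℕ → X) => shift^[n] p.2 :=
    (measurable_shift.iterate n).comp measurable_snd
  have hmeas : inputLaw μ ν (A ∩ E) =
      ∫⁻ p in A, ρ (Prod.mk ((skewShift F)^[n] p).1 ⁻¹' E) ∂inputLaw μ ν := by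
    rw [hAE, ← Measure.map_apply ((hW.mono hle le_rfl).prodMk hsm) hRm,
      map_prod_shift_inputLaw μ ν hW, Measure.prod_apply hRm,
      lintegral_map (measurable_measure_prodMk_left hRm) (hW.mono hle le_rfl),
      ← lintegral_indicator hA']
    refine lintegral_congr fun p => ?_
    by_cases hp : p ∈ A
    · rw [Set.indicator_of_mem hp]
      congr 1
      ext x
      simp [hR, hp]
    · rw [Set.indicator_of_notMem hp]
      have : Prod.mk (((skewShift F)^[n] p).1, p ∈ A) ⁻¹' R = ∅ := by
        ext x
        simp [hR, hp]
      rw [this, measure_empty]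
  have hhs : Measurable fun p => ρ (Prod.mk ((skewShift F)^[n] p).1 ⁻¹' E) :=
    hh.comp (hs.mono hle le_rfl)
  rw [integral_toReal hhs.aemeasurable
    (ae_of_all _ fun p => measure_lt_top _ _), ← hmeas,
    integral_indicator_const _ hE, smul_eq_mul, mul_one, measureReal_restrict_apply hE,
    Set.inter_comm]
  rfl

/-- An invariant event of the driven system is determined by the initial state, up to null sets. -/
lemma exists_ae_eq_preimage_fst_of_invariant (hF : Measurable F)
    (hmp : MeasurePreserving (skewShift F) (inputLaw μ ν) (inputLaw μ ν)) (hE : MeasurableSet E)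
    (hinv : skewShift F ⁻¹' E = E) :
    ∃ A : Set S, MeasurableSet A ∧ E =ᵐ[inputLaw μ ν] Prod.fst ⁻¹' A := by
  set ρ := Measure.infinitePi fun _ : ℕ => ν with hρ
  set h : S → ℝ := fun s => (ρ (Prod.mk s ⁻¹' E)).toReal with hh
  have hm : Measurable h := (measurable_measure_prodMk_left hE).ennreal_toReal
  have h0 : ∀ s, 0 ≤ h s := fun s => ENNReal.toReal_nonneg
  have h1 : ∀ s, h s ≤ 1 := fun s => ENNReal.toReal_mono ENNReal.one_ne_top prob_le_one
  have hlevy : ∀ᵐ p ∂inputLaw μ ν, Tendsto (fun n => h ((skewShift F)^[n] p).1) atTop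
      (𝓝 (E.indicator (fun _ => (1 : ℝ)) p)) := by
    have e := ae_all_iff.2 (condExp_indicator_invariant μ ν hF hE hinv)
    have l := tendsto_ae_condExp (μ := inputLaw μ ν) (ℱ := inputFiltration S X)
      (E.indicator fun _ => (1 : ℝ))
    rw [iSup_inputFiltration, condExp_of_stronglyMeasurable le_rfl
      (stronglyMeasurable_const.indicator hE) ((integrable_const (1 : ℝ)).indicator hE)] at l
    filter_upwards [e, l] with p e l
    exact l.congr fun n => (e n).symm
  have hφm : Measurable fun p : S × (ℕ → X) => h p.1 * (1 - h p.1) :=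
    (hm.comp measurable_fst).mul (measurable_const.sub (hm.comp measurable_fst))
  have hφb : ∀ s, ‖h s * (1 - h s)‖ ≤ 1 := fun s => by
    rw [Real.norm_eq_abs, abs_of_nonneg (mul_nonneg (h0 s) (sub_nonneg.2 (h1 s)))]
    nlinarith [h0 s, h1 s]
  -- Stationarity freezes this integral, while Lévy's 0-1 law sends the integrand to `0`. So it
  -- vanishes at `n = 0` already, and `h` takes only the values `0` and `1`.
  have hconst : ∀ n, ∫ p, h ((skewShift F)^[n] p).1 * (1 - h ((skewShift F)^[n] p).1)
      ∂inputLaw μ ν = ∫ p, h p.1 * (1 - h p.1) ∂inputLaw μ ν := fun n => by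
    conv_rhs => rw [← (hmp.iterate n).map_eq]
    exact (integral_map (hmp.iterate n).measurable.aemeasurable
      hφm.aestronglyMeasurable).symm
  have hlim : Tendsto (fun n => ∫ p, h ((skewShift F)^[n] p).1 * (1 - h ((skewShift F)^[n] p).1)
      ∂inputLaw μ ν) atTop (𝓝 (∫ _, (0 : ℝ) ∂inputLaw μ ν)) := by
    refine tendsto_integral_of_dominated_convergence (fun _ => (1 : ℝ)) (fun n => ?_)
      (integrable_const _) (fun n => ae_of_all _ fun p => hφb _) ?_
    · exact (hφm.comp (hmp.iterate n).measurable).aestronglyMeasurable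
    · filter_upwards [hlevy] with p hp
      have := hp.mul (hp.const_sub 1)
      by_cases hpE : p ∈ E <;> simpa [hpE] using this
  simp only [hconst, integral_zero] at hlim
  have hzero := tendsto_nhds_unique tendsto_const_nhds hlim
  rw [integral_eq_zero_iff_of_nonneg (fun p => mul_nonneg (h0 _) (sub_nonneg.2 (h1 _)))
    (Integrable.of_bound hφm.aestronglyMeasurable 1 (ae_of_all _ fun p => hφb _))] at hzero
  have h01 : ∀ᵐ s ∂μ, h s * (1 - h s) = 0 := by
    have hfst : (inputLaw μ ν).map Prod.fst = μ := by
      rw [Measure.map_fst_prod, measure_univ, one_smul]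
    rw [← hfst]
    exact (ae_map_iff measurable_fst.aemeasurable (measurableSet_eq_fun
      (hm.mul (measurable_const.sub hm)) measurable_const)).2 hzero
  have hA : MeasurableSet {s | h s = 1} := measurableSet_eq_fun hm measurable_const
  refine ⟨{s | h s = 1}, hA, ae_eq_set.2 ⟨?_, ?_⟩⟩
  · rw [Measure.measure_prod_null (hE.diff (measurable_fst hA))]
    filter_upwards [h01] with s hs
    by_cases hs1 : h s = 1
    · have : Prod.mk s ⁻¹' (E \ Prod.fst ⁻¹' {s | h s = 1}) = ∅ := by
        ext x
        simp [hs1]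
      rw [this, measure_empty]
      rfl
    · have hs0 : h s = 0 := (mul_eq_zero.1 hs).resolve_right fun h2 => hs1 (by linarith)
      refine measure_mono_null (t := Prod.mk s ⁻¹' E) (fun x hx => hx.1) ?_
      exact (ENNReal.toReal_eq_zero_iff _).1 hs0 |>.resolve_right (measure_ne_top _ _)
  · rw [Measure.measure_prod_null ((measurable_fst hA).diff hE)]
    refine ae_of_all _ fun s => ?_
    by_cases hs1 : h s = 1
    · refine measure_mono_null (t := (Prod.mk s ⁻¹' E)ᶜ) (fun x hx => hx.2) ?_
      rw [prob_compl_eq_zero_iff (measurable_prodMk_left hE)]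
      exact (ENNReal.toReal_eq_one_iff _).1 hs1
    · have : Prod.mk s ⁻¹' (Prod.fst ⁻¹' {s | h s = 1} \ E) = ∅ := by
        ext x
        simp [hs1]
      beta_reduce
      rw [this, measure_empty]
      rfl

/-- Invariant events reduce to sets of states, but only up to null sets, which is why `htriv` is
asked of almost invariant sets. -/
theorem ergodic_skewShift (hF : Measurable F)
    (hμ : (inputLaw μ ν).map (fun p => (skewShift F p).1) = μ)
    (htriv : ∀ A : Set S, MeasurableSet A →
      skewShift F ⁻¹' (Prod.fst ⁻¹' A) =ᵐ[inputLaw μ ν] (Prod.fst ⁻¹' A : Set (S × (ℕ → X))) →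
      EventuallyConst (Prod.fst ⁻¹' A : Set (S × (ℕ → X))) (ae (inputLaw μ ν))) :
    Ergodic (skewShift F) (inputLaw μ ν) := by
  have hmp := measurePreserving_skewShift μ ν hF hμ
  refine ⟨hmp, ⟨fun E hE hinv => ?_⟩⟩
  obtain ⟨A, hA, hEA⟩ := exists_ae_eq_preimage_fst_of_invariant μ ν hF hmp hE hinv
  refine (htriv A hA ?_).congr hEA.symm
  have := hmp.quasiMeasurePreserving.preimage_ae_eq hEA
  rw [hinv] at this
  exact this.symm.trans hEA

/-- A factor of an ergodic system is stationary and ergodic. -/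
lemma isStationaryErgodic_of_ergodic {α Z : Type*} [MeasurableSpace α] [MeasurableSpace Z]
    {M : Measure α} {T : α → α} (hT : Ergodic T M) {g : α → Z} (hg : Measurable g) :
    IsStationaryErgodic M fun t p => g (T^[t] p) := by
  have hm : Measurable fun (p : α) (t : ℕ) => g (T^[t] p) :=
    measurable_pi_lambda _ fun t => hg.comp (hT.measurable.iterate t)
  exact MeasurePreserving.ergodic_of_ergodic_semiconj ⟨hm, rfl⟩ hT measurable_shift fun p => rfl

lemma isStationaryErgodic_comp_iff {Ω α Z : Type*} [MeasurableSpace Ω] [MeasurableSpace α]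
    [MeasurableSpace Z] {P : Measure Ω} {M : Measure α} {q : Ω → α}
    (hq : MeasurePreserving q P M) {W : ℕ → α → Z} (hW : ∀ t, Measurable (W t)) :
    IsStationaryErgodic P (fun t ω => W t (q ω)) ↔ IsStationaryErgodic M W := by
  have hm : Measurable fun (p : α) (t : ℕ) => W t p := measurable_pi_lambda _ hW
  unfold IsStationaryErgodic
  rw [← hq.map_eq, Measure.map_map hm hq.measurable]
  rfl

/-- If the process of observations of the driven system is stationary and ergodic, and the
observations reveal the state, then the driven system is ergodic jointly with its inputs. -/
theorem ergodic_skewShift_of_isStationaryErgodic {Z : Type*} [MeasurableSpace Z]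
    (hF : Measurable F) {obs : S × X → Z} (hobs : Measurable obs) {proj : Z → S}
    (hproj : Measurable proj) (hpo : ∀ q, proj (obs q) = q.1)
    (hZ : IsStationaryErgodic (inputLaw μ ν) fun t p =>
      obs (((skewShift F)^[t] p).1, ((skewShift F)^[t] p).2 0)) :
    Ergodic (skewShift F) (inputLaw μ ν) := by
  have hstep := measurable_skewShift (X := X) hF
  have hpath : Measurable fun (p : S × (ℕ → X)) (t : ℕ) =>
      obs (((skewShift F)^[t] p).1, ((skewShift F)^[t] p).2 0) :=
    measurable_pi_lambda _ fun t => hobs.comp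
      ((measurable_fst.comp (hstep.iterate t)).prodMk
        ((measurable_pi_apply 0).comp (measurable_snd.comp (hstep.iterate t))))
  set path : S × (ℕ → X) → ℕ → Z := fun p t =>
    obs (((skewShift F)^[t] p).1, ((skewShift F)^[t] p).2 0) with hpathdef
  have hZ' : Ergodic shift ((inputLaw μ ν).map path) := hZ
  have hmp : MeasurePreserving path (inputLaw μ ν) ((inputLaw μ ν).map path) := ⟨hpath, rfl⟩
  have hinit : Measurable fun z : ℕ → Z => proj (z 0) := hproj.comp (measurable_pi_apply 0)
  have hpath0 : ∀ p, proj (path p 0) = p.1 := fun p => hpo _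
  have hpath1 : ∀ p, proj (shift (path p) 0) = (skewShift F p).1 := fun p => hpo _
  refine ergodic_skewShift μ ν hF ?_ fun A hA hAinv => ?_
  -- Stationarity of the observations passes through `proj` to the state, so `μ` is an invariant law
  -- for the state.
  · have h0 : (inputLaw μ ν).map (fun p => proj (path p 0)) = μ := by
      simp only [hpath0]
      rw [Measure.map_fst_prod, measure_univ, one_smul]
    have h1 := ((hZ'.toMeasurePreserving.comp hmp).map_eq).trans hmp.map_eq.symm
    have h2 := congrArg (Measure.map fun z : ℕ → Z => proj (z 0)) h1
    rw [Measure.map_map hinit (measurable_shift.comp hpath), Measure.map_map hinit hpath] at h2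
    simp only [← hpath1]
    exact h2.trans h0
  -- Since observations reveal the state, an almost invariant set of states is an almost invariant
  -- event of the observed path, and ergodicity of the latter applies.
  · set B : Set (ℕ → Z) := {z | proj (z 0) ∈ A} with hB
    have hBm : MeasurableSet B := hinit hA
    have hpre : path ⁻¹' B = Prod.fst ⁻¹' A := by
      ext p
      simp only [hB, Set.mem_preimage, Set.mem_ofPred_eq, hpath0]
    have hpre' : path ⁻¹' (shift ⁻¹' B) = skewShift F ⁻¹' (Prod.fst ⁻¹' A) := by
      ext p
      simp only [hB, Set.mem_preimage, Set.mem_ofPred_eq, hpath1]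
    have hBinv : shift ⁻¹' B =ᵐ[(inputLaw μ ν).map path] B := by
      have h := ae_eq_set.1 hAinv
      rw [← hpre', ← hpre, ← Set.preimage_sdiff, ← Set.preimage_sdiff,
        hmp.measure_preimage ((measurable_shift hBm).diff hBm).nullMeasurableSet,
        hmp.measure_preimage (hBm.diff (measurable_shift hBm)).nullMeasurableSet] at h
      exact ae_eq_set.2 h
    rw [eventuallyConst_set', ← hpre]
    exact (hZ'.quasiErgodic.ae_empty_or_univ₀ hBm.nullMeasurableSet hBinv).imp
      (fun h => hmp.quasiMeasurePreserving.preimage_ae_eq h)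
      (fun h => hmp.quasiMeasurePreserving.preimage_ae_eq h)

end SkewProduct

/-! ### Measurability for `Option` -/

section OptionMeasurability

variable {α β γ : Type*} [MeasurableSpace α] [MeasurableSpace β] [MeasurableSpace γ]

lemma measurable_some : Measurable (some : α → Option α) := fun _ hs => hs

lemma measurable_of_comp_some {f : Option α → β} (hf : Measurable (f ∘ some)) : Measurable f :=
  fun _ hs => hf hs

lemma measurable_isSome : Measurable (Option.isSome : Option α → Bool) :=
  measurable_of_comp_some measurable_const

lemma measurableSet_isSome {f : γ → Option α} (hf : Measurable f) :
    MeasurableSet {c | (f c).isSome} :=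
  measurable_isSome.comp hf (measurableSet_singleton true)

/-- The default element only makes the rewriting total; it is used where the result is `none`
anyway. -/
lemma measurable_option_bind [Inhabited α] {f : γ → Option α} {g : γ → α → Option β}
    (hf : Measurable f) (hg : Measurable (Function.uncurry g)) :
    Measurable fun c => (f c).bind (g c) := by
  have h : (fun c => (f c).bind (g c)) = fun c =>
      if (f c).isSome then g c ((f c).getD default) else none := by
    ext1 c
    cases f c <;> rfl
  have hd : Measurable fun o : Option α => o.getD default :=
    measurable_of_comp_some measurable_id
  rw [h]
  exact Measurable.ite (measurableSet_isSome hf) (hg.comp (measurable_id.prodMk (hd.comp hf)))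
    measurable_const

end OptionMeasurability

/-! ### Measurability of the network model, and ergodicity of deliveries -/

section ModelMeasurability

variable {V : Type*} {G : SimpleGraph V}

lemma NoiseModel.measurable_purifyProb (m : NoiseModel) {γ : Type*} [MeasurableSpace γ]
    {f g : γ → ℝ} (hf : Measurable f) (hg : Measurable g) :
    Measurable fun c => m.purifyProb (f c) (g c) := by
  cases m <;> simp only [NoiseModel.purifyProb] <;> fun_prop

lemma NoiseModel.measurable_purifyFidelity (m : NoiseModel) {γ : Type*} [MeasurableSpace γ]
    {f g : γ → ℝ} (hf : Measurable f) (hg : Measurable g) :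
    Measurable fun c => m.purifyFidelity (f c) (g c) := by
  cases m
  · exact (hf.mul hg).div (NoiseModel.measurable_purifyProb .bitFlip hf hg)
  · exact Measurable.div (by fun_prop) (NoiseModel.measurable_purifyProb .werner hf hg)

lemma Network.measurable_decay (net : Network G) : Measurable net.decay := by
  unfold Network.decay wernerFidelity wernerParam
  fun_prop

lemma Network.measurable_store (net : Network G) : Measurable net.store := by
  refine Measurable.ite ?_ (measurable_some.comp ?_) measurable_const
  · refine MeasurableSet.inter ?_ (measurableSet_le measurable_const
      (net.measurable_decay.comp measurable_snd))
    exact measurable_fst (MeasurableSet.of_discrete (s := {k : ℕ | k + 1 < net.memory}))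
  · exact ((measurable_of_countable fun k : ℕ => k + 1).comp measurable_fst).prodMk
      (net.measurable_decay.comp measurable_snd)

lemma Network.measurable_pool (net : Network G) (n : External G) (e : G.edgeSet)
    (r : net.PairName e) : Measurable fun s : net.Inventory => net.pool n s e r := by
  cases r with
  | inl i => exact (measurable_pi_apply i).comp (measurable_pi_apply e)
  | inr i => exact measurable_const

lemma Network.measurable_afterPurify (net : Network G) (n : External G) (a : net.Action)
    (e : G.edgeSet) (r : net.PairName e) :
    Measurable fun c : net.Inventory × net.Internal => net.afterPurify n c.1 a c.2 e r := by
  unfold Network.afterPurify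
  cases h : a.purify e r with
  | none =>
    by_cases h' : ∃ r', a.purify e r' = some r
    · simp only [h', if_true]
      exact measurable_const
    · simp only [h', if_false]
      exact (net.measurable_pool n e r).comp measurable_fst
  | some r' =>
    refine measurable_option_bind ((net.measurable_pool n e r).comp measurable_fst) ?_
    refine measurable_option_bind
      (f := fun c : (net.Inventory × net.Internal) × Pair => net.pool n c.1.1 e r')
      ((net.measurable_pool n e r').comp (measurable_fst.comp measurable_fst)) ?_
    have hp : Measurable fun c : ((net.Inventory × net.Internal) × Pair) × Pair => c.1.2.2 :=
      measurable_snd.comp (measurable_snd.comp measurable_fst)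
    have hp' : Measurable fun c : ((net.Inventory × net.Internal) × Pair) × Pair => c.2.2 :=
      measurable_snd.comp measurable_snd
    have hw : Measurable fun c : ((net.Inventory × net.Internal) × Pair) × Pair =>
        (c.1.1.2.1 e r : ℝ) :=
      measurable_subtype_coe.comp ((measurable_pi_apply r).comp ((measurable_pi_apply e).comp
        (measurable_fst.comp (measurable_snd.comp (measurable_fst.comp measurable_fst)))))
    refine Measurable.ite (measurableSet_lt hw (net.noise.measurable_purifyProb hp hp'))
      (measurable_some.comp ?_) measurable_const
    exact (measurable_fst.comp (measurable_snd.comp measurable_fst)).prodMk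
      (net.noise.measurable_purifyFidelity hp hp')

lemma Network.measurable_next (net : Network G) (n : External G) (a : net.Action) :
    Measurable fun c : net.Inventory × net.Internal => net.next n c.1 a c.2 := by
  refine measurable_pi_lambda _ fun e => measurable_pi_lambda _ fun i => ?_
  unfold Network.next
  cases a.keep e i with
  | none => exact measurable_const
  | some r =>
    exact measurable_option_bind
      (f := fun c : net.Inventory × net.Internal => net.afterPurify n c.1 a c.2 e r)
      (g := fun _ => net.store) (net.measurable_afterPurify n a e r)
      (net.measurable_store.comp measurable_snd)

/-- The stored pairs of the next slot, from those of the current slot and its randomness. -/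
noncomputable def Network.step (net : Network G) (φ : net.Policy)
    (c : net.Inventory × net.SlotNoise) : net.Inventory :=
  net.next (net.observe φ c.1 c.2).1 (net.observe φ c.1 c.2).2.1 (net.observe φ c.1 c.2).2.2 c.2.2

/-- Identifies the network with a driven system whose state is the inventory and whose inputs are
the slot noises. -/
lemma Network.skewShift_step_iterate {Ω : Type*} (net : Network G) (φ : net.Policy) (s₀ : Ω → net.Inventory)
    (ξ : ℕ → Ω → net.SlotNoise) (t : ℕ) (ω : Ω) :
    ((skewShift (net.step φ))^[t] (s₀ ω, fun r => ξ r ω)).1 = net.inventory φ s₀ ξ t ω ∧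
      ((skewShift (net.step φ))^[t] (s₀ ω, fun r => ξ r ω)).2 0 = ξ t ω := by
  have h2 : ∀ t, ((skewShift (net.step φ))^[t] (s₀ ω, fun r => ξ r ω)).2 0 = ξ t ω := fun t => by
    rw [skewShift_iterate_snd, shift_iterate, zero_add]
  refine ⟨?_, h2 t⟩
  induction t with
  | zero => rfl
  | succ t ih =>
    rw [Function.iterate_succ_apply', skewShift, ih, h2]
    rfl

variable [Fintype V] [DecidableRel G.Adj]

lemma Network.measurable_observe (net : Network G) (φ : net.Policy) :
    Measurable fun c : net.Inventory × net.SlotNoise => net.observe φ c.1 c.2 := by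
  have hr : Measurable fun c : net.Inventory × net.SlotNoise => net.retained c.2.1.1 :=
    (measurable_of_countable net.retained).comp
      (measurable_fst.comp (measurable_fst.comp measurable_snd))
  exact hr.prodMk (measurable_fst.prodMk (φ.measurable_act.comp (hr.prodMk
    (measurable_fst.prodMk (measurable_snd.comp (measurable_fst.comp measurable_snd))))))

/-- A path is determined by its list of vertices. Countability of actions allows measurability to be
checked one action at a time. -/
instance Network.countable_activation (net : Network G) : Countable net.Activation := by
  have hpath : ∀ u v : V, Countable (G.Path u v) := fun u v =>
    Function.Injective.countable (f := fun p : G.Path u v => (p : G.Walk u v).support)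
      fun p q h => Subtype.ext (SimpleGraph.Walk.ext_support h)
  exact Function.Injective.countable
    (f := fun A : net.Activation =>
      (⟨A.flow, A.path, A.pick⟩ : Σ f : V × V, G.Path f.1 f.2 × ∀ e : G.edgeSet, net.PairName e))
    fun ⟨_, _, _⟩ ⟨_, _, _⟩ h => by cases h; rfl

instance Network.countable_action (net : Network G) : Countable net.Action :=
  Function.Injective.countable (f := fun a : net.Action => (a.activate, a.purify, a.keep))
    fun ⟨_, _, _⟩ ⟨_, _, _⟩ h => by cases h; rfl

instance Network.measurableSingletonClass_action (net : Network G) :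
    MeasurableSingletonClass net.Action := ⟨fun _ => trivial⟩

/-- A property of external multigraph, stored pairs, action and internal randomness may be checked
for each of the countably many multigraphs and actions. -/
lemma Network.measurable_of_fixed_action (net : Network G) (φ : net.Policy) {β : Type*}
    [MeasurableSpace β] {f : External G → net.Inventory → net.Action → net.Internal → β}
    (hf : ∀ n a, Measurable fun c : net.Inventory × net.Internal => f n c.1 a c.2) :
    Measurable fun c : net.Inventory × net.SlotNoise =>
      f (net.observe φ c.1 c.2).1 (net.observe φ c.1 c.2).2.1 (net.observe φ c.1 c.2).2.2
        c.2.2 := by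
  have h : Measurable fun d : (External G × net.Action) × (net.Inventory × net.Internal) =>
      f d.1.1 d.2.1 d.1.2 d.2.2 :=
    measurable_from_prod_countable_right fun d => hf d.1 d.2
  have ho := net.measurable_observe φ
  have ho2 := measurable_snd.comp ho
  exact h.comp (((measurable_fst.comp ho).prodMk (measurable_snd.comp ho2)).prodMk
    ((measurable_fst.comp ho2).prodMk (measurable_snd.comp measurable_snd)))

lemma Network.measurable_step (net : Network G) (φ : net.Policy) : Measurable (net.step φ) :=
  net.measurable_of_fixed_action φ net.measurable_next

variable [DecidableEq V]

lemma Network.measurable_endFidelity (net : Network G) (n : External G) (a : net.Action)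
    (A : net.Activation) :
    Measurable fun c : net.Inventory × net.Internal => net.endFidelity n c.1 a c.2 A := by
  have hw : Measurable wernerParam := by unfold wernerParam; fun_prop
  have hw' : Measurable wernerFidelity := by unfold wernerFidelity; fun_prop
  refine hw'.comp (Finset.measurable_fun_prod _ fun e _ => ?_)
  by_cases h : A.Uses e
  · simp only [h, if_true]
    have he : Measurable fun o : Option Pair => o.elim 0 fun p => wernerParam p.2 :=
      measurable_of_comp_some (hw.comp measurable_snd)
    exact he.comp (net.measurable_afterPurify n a e _)
  · simp only [h, if_false]
    exact measurable_const

lemma Network.measurableSet_usable (net : Network G) (flow : V × V) (n : External G)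
    (a : net.Action) :
    MeasurableSet {c : net.Inventory × net.Internal | net.Usable flow n c.1 a c.2} := by
  have h : {c : net.Inventory × net.Internal | net.Usable flow n c.1 a c.2} =
      ⋃ (j) (A) (_ : a.activate j = some A ∧ A.flow = flow),
        ((⋂ (e) (_ : A.Uses e), {c | 1 ≤ n e ∧ (net.afterPurify n c.1 a c.2 e (A.pick e)).isSome}) ∩
          ((⋂ (v) (_ : v ∈ (A.path : G.Walk A.flow.1 A.flow.2).support ∧ v ≠ flow.1 ∧ v ≠ flow.2),
            {c | c.2.2 j v = true}) ∩ {c | net.threshold ≤ net.endFidelity n c.1 a c.2 A})) := by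
    ext c
    simp only [Network.Usable, Set.mem_ofPred_eq, Set.mem_iUnion, Set.mem_inter_iff,
      Set.mem_iInter, exists_prop, and_assoc, and_imp]
  rw [h]
  refine .iUnion fun j => .iUnion fun A => .iUnion fun _ => .inter ?_ (.inter ?_ ?_)
  · exact .iInter fun e => .iInter fun _ => (MeasurableSet.const _).inter
      (measurableSet_isSome (net.measurable_afterPurify n a e _))
  · refine .iInter fun v => .iInter fun _ => ?_
    have hb : Measurable fun c : net.Inventory × net.Internal => c.2.2 j v :=
      (measurable_pi_apply v).comp ((measurable_pi_apply j).comp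
        (measurable_snd.comp measurable_snd))
    exact hb (measurableSet_singleton true)
  · exact measurableSet_le measurable_const (net.measurable_endFidelity n a A)

open Classical in
/-- The delivery indicator of a slot, from the stored pairs and the randomness of the slot. -/
noncomputable def Network.deliver (net : Network G) (φ : net.Policy) (flow : V × V)
    (c : net.Inventory × net.SlotNoise) : ℕ :=
  if net.Usable flow (net.observe φ c.1 c.2).1 (net.observe φ c.1 c.2).2.1
    (net.observe φ c.1 c.2).2.2 c.2.2 then 1 else 0

lemma Network.measurable_deliver (net : Network G) (φ : net.Policy) (flow : V × V) :
    Measurable (net.deliver φ flow) := by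
  classical
  exact net.measurable_of_fixed_action φ
    (f := fun n s a w => if net.Usable flow n s a w then 1 else 0) fun n a =>
    Measurable.ite (net.measurableSet_usable flow n a) measurable_const measurable_const

lemma Network.delivery_eq {Ω : Type*} (net : Network G) (φ : net.Policy) (flow : V × V)
    (s₀ : Ω → net.Inventory) (ξ : ℕ → Ω → net.SlotNoise) :
    net.delivery φ flow s₀ ξ = fun t ω => net.deliver φ flow
      (((skewShift (net.step φ))^[t] (s₀ ω, fun r => ξ r ω)).1,
        ((skewShift (net.step φ))^[t] (s₀ ω, fun r => ξ r ω)).2 0) := by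
  ext t ω
  obtain ⟨h1, h2⟩ := net.skewShift_step_iterate φ s₀ ξ t ω
  rw [h1, h2]
  rfl

variable {Ω : Type*} [MeasurableSpace Ω] {P : Measure Ω} [IsProbabilityMeasure P]

lemma Network.IsDriven.measurePreserving {net : Network G} {s₀ : Ω → net.Inventory}
    {ξ : ℕ → Ω → net.SlotNoise} (hξ : net.IsDriven P s₀ ξ) [IsProbabilityMeasure net.slotLaw] :
    MeasurePreserving (fun ω => (s₀ ω, fun r => ξ r ω)) P
      (inputLaw (P.map s₀) net.slotLaw) := by
  have hm : Measurable fun ω t => ξ t ω := measurable_pi_lambda _ hξ.measurable_noise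
  refine ⟨hξ.measurable_init.prodMk hm, ?_⟩
  rw [(indepFun_iff_map_prod_eq_prod_map_map hξ.measurable_init.aemeasurable
    hm.aemeasurable).1 hξ.indep_init, hξ.indep_noise.map_fun_eq_infinitePi_map hξ.measurable_noise]
  simp only [hξ.law_noise]

/-- Deliveries also depend on the internal randomness of a slot, which is not part of the state;
nevertheless they inherit stationarity and ergodicity from the state process. -/
theorem Network.isStationaryErgodic_delivery {net : Network G} {φ : net.Policy}
    {s₀ : Ω → net.Inventory} {ξ : ℕ → Ω → net.SlotNoise} (hξ : net.IsDriven P s₀ ξ)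
    (hZ : IsStationaryErgodic P (net.state φ s₀ ξ)) (flow : V × V) :
    (∀ t, Measurable (net.delivery φ flow s₀ ξ t)) ∧
      IsStationaryErgodic P (net.delivery φ flow s₀ ξ) := by
  have hν : IsProbabilityMeasure net.slotLaw := by
    rw [← hξ.law_noise 0]
    exact Measure.isProbabilityMeasure_map (hξ.measurable_noise 0).aemeasurable
  have hμ : IsProbabilityMeasure (P.map s₀) :=
    Measure.isProbabilityMeasure_map hξ.measurable_init.aemeasurable
  have hq := hξ.measurePreserving
  have hF := net.measurable_step φ
  have hslot : Measurable fun p : net.Inventory × (ℕ → net.SlotNoise) => (p.1, p.2 0) :=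
    measurable_fst.prodMk ((measurable_pi_apply 0).comp measurable_snd)
  have hiter := fun t => hslot.comp ((measurable_skewShift hF).iterate t)
  have hstate : net.state φ s₀ ξ = fun t ω => (fun c : net.Inventory × net.SlotNoise =>
      net.observe φ c.1 c.2) (((skewShift (net.step φ))^[t] (s₀ ω, fun r => ξ r ω)).1,
        ((skewShift (net.step φ))^[t] (s₀ ω, fun r => ξ r ω)).2 0) := by
    ext1 t
    ext1 ω
    obtain ⟨h1, h2⟩ := net.skewShift_step_iterate φ s₀ ξ t ω
    rw [h1, h2]
    rfl
  have herg : Ergodic (skewShift (net.step φ)) (inputLaw (P.map s₀) net.slotLaw) := by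
    -- The inventory is a component of `Z`, so the observation reveals the state of the driven
    -- system.
    refine ergodic_skewShift_of_isStationaryErgodic _ _ hF (net.measurable_observe φ)
      (proj := fun z => z.2.1) (measurable_fst.comp measurable_snd) (fun _ => rfl) ?_
    rw [hstate] at hZ
    exact (isStationaryErgodic_comp_iff hq
      fun t => (net.measurable_observe φ).comp (hiter t)).1 hZ
  rw [net.delivery_eq]
  have hd := fun t => (net.measurable_deliver φ flow).comp (hiter t)
  exact ⟨fun t => (hd t).comp hq.measurable, (isStationaryErgodic_comp_iff hq hd).2
    (isStationaryErgodic_of_ergodic herg ((net.measurable_deliver φ flow).comp hslot))⟩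

end ModelMeasurability

end FidelityAge

/-! ### The Fidelity-Age renewal identity -/

open FidelityAge in
theorem theorem1 {V : Type*} [Fintype V] [DecidableEq V] {G : SimpleGraph V} [DecidableRel G.Adj]
    (net : Network G) (φ : net.Policy) (flow : V × V) (hflow : flow ∈ net.requests)
    {Ω : Type*} [MeasurableSpace Ω] (P : Measure Ω) [IsProbabilityMeasure P]
    (s₀ : Ω → net.Inventory) (ξ : ℕ → Ω → net.SlotNoise) (hξ : net.IsDriven P s₀ ξ)
    (hZ : IsStationaryErgodic P (net.state φ s₀ ξ))
    (Y : ℕ → Ω → ℕ) (hY : Y = net.delivery φ flow s₀ ξ)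
    (t : ℕ) (hpos : 0 < P {ω | Y t ω = 1}) (hlt : P {ω | Y t ω = 1} < 1)
    (τ : Ω → ℝ≥0∞) (hτ : ∀ ω, τ ω = (interDelivery (fun r => Y r ω) t : ℝ≥0∞))
    (m₁ m₂ : ℝ≥0∞) (hm₁ : m₁ = ∫⁻ ω, τ ω ∂P[|{ω | Y t ω = 1}])
    (hm₂ : m₂ = ∫⁻ ω, τ ω ^ 2 ∂P[|{ω | Y t ω = 1}])
    (hfin₁ : m₁ < ∞) (hfin₂ : m₂ < ∞) :
    (∀ᵐ ω ∂P, Tendsto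
      (fun T : ℝ => T⁻¹ * ∫ u in (0 : ℝ)..T, fidelityAge net.slot (fun r => Y r ω) u) atTop
      (𝓝 (net.slot * (m₂.toReal / (2 * m₁.toReal))))) ∧
    (∀ p : ℝ, 0 < p → p ≤ 1 →
      (∀ k : ℕ, P[|{ω | Y t ω = 1}] {ω | τ ω = ((k + 1 : ℕ) : ℝ≥0∞)} =
        ENNReal.ofReal ((1 - p) ^ k * p)) →
      ∀ᵐ ω ∂P, Tendsto
        (fun T : ℝ => T⁻¹ * ∫ u in (0 : ℝ)..T, fidelityAge net.slot (fun r => Y r ω) u) atTop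
        (𝓝 (net.slot * ((2 - p) / (2 * p))))) := by
  have hτ' : τ = fun ω => (interDelivery (fun r => Y r ω) t : ℝ≥0∞) := funext hτ
  obtain ⟨hYm, hYe⟩ := Network.isStationaryErgodic_delivery hξ hZ flow
  rw [← hY] at hYm hYe
  have key := ae_tendsto_average_fidelityAge_of_isStationaryErgodic hYm hYe hpos
    (by rw [← hτ', ← hm₁]; exact hfin₁) (by simp only [← hτ, ← hm₂]; exact hfin₂) net.slot_pos
  simp only [← hτ, ← hm₁, ← hm₂] at key
  refine ⟨key, fun p hp hp1 hgeom => ?_⟩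
  have hτm : Measurable τ := by
    rw [hτ']
    exact (measurable_interDelivery t).comp (measurable_pi_lambda _ hYm)
  have : IsProbabilityMeasure P[|{ω | Y t ω = 1}] := cond_isProbabilityMeasure hpos.ne'
  have e₁ := lintegral_pow_of_geometric (j := 1) hτm hp hp1 hgeom
    (by simpa only [pow_one] using hasSum_succ_mul_geometric hp hp1)
  have e₂ := lintegral_pow_of_geometric (j := 2) hτm hp hp1 hgeom
    (hasSum_succ_sq_mul_geometric hp hp1)
  simp only [pow_one] at e₁
  rw [← hm₁] at e₁
  rw [← hm₂] at e₂
  have h2p : 0 ≤ 2 - p := by linarith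
  -- Here `m₁ = 1 / p` and `m₂ = (2 - p) / p²`.
  have hlim : m₂.toReal / (2 * m₁.toReal) = (2 - p) / (2 * p) := by
    rw [e₁, e₂, ENNReal.toReal_ofReal (by positivity), ENNReal.toReal_ofReal (by positivity)]
    field_simp
  rwa [hlim] at key
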